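/- Let $k$ be a global function field with finite constant field $\mathbb F_q$ (finitely generated of transcendence degree one over $\mathbb F_q$, with $\mathbb F_q$ algebraically closed in $k$). Fix a place $\infty$ of $k$; let $A\subset k$ be the ring of functions regular away from $\infty$, $k_\infty$ the completion of $k$ at $\infty$, and $\mathbb C_\infty$ the completion of an algebraic closure of $k_\infty$, with the absolute value $|\cdot|_\infty$ extending $|x|_\infty=q_\infty^{-\operatorname{ord}_\infty(x)}$ on $k$, where $q_\infty$ is the cardinality of the residue field at $\infty$. Let $r\ge 1$, let $Y\subset k^r$ be a projective $A$-module of rank $r$, and let $z=(z_1:\dots:z_{r-1}:1)\in\mathbb P^{r-1}(\mathbb C_\infty)$ be a point lying on no $k_\infty$-rational hyperplane. Put $$\Lambda=\Lambda^Y_z=\{y_1z_1+\dots+y_{r-1}z_{r-1}+y_r:(y_1,\dots,y_r)\in Y\},$$ $$\operatorname{Im}(z)=\prod_{i=1}^{r-1}\ \inf_{u_{i+1},\dots,u_r\in k_\infty}\Big|z_i+\sum_{j=i+1}^{r-1}u_jz_j+u_r\Big|_\infty .$$ Then every ball in $\mathbb C_\infty$ contains only finitely many elements of $\Lambda$. The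 series $$\mathbb E^Y(z,s)=\sum_{0\ne\lambda\in\Lambda}\frac{\operatorname{Im}(z)^s}{|\lambda|_\infty^{rs}}$$ converges absolutely for $\operatorname{Re}(s)>1$ and has a unique meromorphic continuation to $\mathbb C$, again denoted by $\mathbb E^Y(z,s)$. For every $a\in A\setminus\mathbb F_q$ the following hold. (1) The group $\tfrac1a\Lambda/\Lambda$ is finite, and for every choice of representatives $w$ of its nonzero classes and every $s\in\mathbb C$ with $|a|_\infty^{rs}\ne|a|_\infty^r$, $$\mathbb E^Y(z,s)=\frac{\operatorname{Im}(z)^s}{|a|_\infty^{rs}-|a|_\infty^r}\sum_{0\ne w\in\frac1a\Lambda/\Lambda}\Bigg[\frac1{|w|_\infty^{rs}}+\sum_{\substack{0\ne\lambda\in\Lambda\\|\lambda|_\infty\le|w|_\infty}}\bigg(\frac1{|\lambda-w|_\infty^{rs}}-\frac1{|\lambda|_\infty^{rs}}\bigg)\Bigg].$$ (2) The group $\Lambda/a\Lambda$ is finite, the function $\big(1-|a|_\infty^{r(1-s)}\big)\operatorname{Im}(z)^{-s}\,\mathbb E^Y(z,s)$ is analytic at $s=0$, and for every choice of representatives $w$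 of the nonzero classes of $\Lambda/a\Lambda$ and every integer $n\ge0$, $$\frac{\partial^n}{\partial s^n}\bigg(\frac{1-|a|_\infty^{r(1-s)}}{\operatorname{Im}(z)^s}\,\mathbb E^Y(z,s)\bigg)\bigg|_{s=0}=(-r)^n\sum_{0\ne w\in\Lambda/a\Lambda}\Bigg[\ln^n|w|_\infty+\sum_{\substack{0\ne\lambda\in a\Lambda\\|\lambda|_\infty\le|w|_\infty}}\Big(\ln^n|\lambda-w|_\infty-\ln^n|\lambda|_\infty\Big)\Bigg],$$ where $\ln^n x=(\ln x)^n$. -/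

import Mathlib

noncomputable section

namespace DrinfeldEisenstein

open scoped WithZero NNReal

/-- A place of a field `k`: a normalized (i.e. surjective) discrete valuation
`k → ℤᵐ⁰ = ℤ ∪ {-∞}`, written multiplicatively, so that `val x = exp (-ord x)` for `x ≠ 0`.
Over a function field with finite constant field each valuation is trivial on the constants,
so these are exactly the places in the usual sense. -/
structure Place (k : Type*) [Field k] where
  val : Valuation k ℤᵐ⁰
  surj : Function.Surjective val

section Basic

variable {k : Type*} [Field k]

namespace Place

/-- The cardinality `q_v` of the residue field at `v`. -/
def q (v : Place k) : ℕ := Nat.card (IsLocalRing.ResidueField v.val.valuationSubring)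

/-- The base of the normalized absolute value, which is `q_v`. Places of global function fields have
finite residue fields, so `2 ≤ q_v`, and the maximum only makes the definition total. -/
def base (v : Place k) : ℝ≥0 := max 2 (v.q : ℝ≥0)

theorem one_lt_base (v : Place k) : 1 < v.base :=
  lt_of_lt_of_le one_lt_two (le_max_left _ _)

theorem abs_add_le_max (v : Place k) (x y : k) :
    WithZeroMulInt.toNNReal v.one_lt_base.ne_zero (v.val (x + y)) ≤
      max (WithZeroMulInt.toNNReal v.one_lt_base.ne_zero (v.val x))
        (WithZeroMulInt.toNNReal v.one_lt_base.ne_zero (v.val y)) := by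
  have h := (WithZeroMulInt.toNNReal_strictMono v.one_lt_base).monotone
  rw [← h.map_max]
  exact h (v.val.map_add x y)

/-- The normalized absolute value `|x|_v = q_v ^ (-ord_v x)`. -/
def abs (v : Place k) : AbsoluteValue k ℝ where
  toFun x := (WithZeroMulInt.toNNReal v.one_lt_base.ne_zero (v.val x) : ℝ≥0)
  map_mul' x y := by simp
  nonneg' x := NNReal.coe_nonneg _
  eq_zero' x := by simp
  add_le' x y := by
    rw [← NNReal.coe_add, NNReal.coe_le_coe]
    exact (v.abs_add_le_max x y).trans (max_le_add_of_nonneg zero_le zero_le)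

/-- The ring `A` of functions in `k` that are regular away from the place `v = ∞`. -/
def ringAway (v : Place k) : Subring k :=
  ⨅ w : {w : Place k // w ≠ v}, w.1.val.valuationSubring.toSubring

/-- The completion `k_∞` of `k` at `v = ∞`, with the norm extending `|·|_∞`. -/
abbrev KInf (v : Place k) : Type _ := v.abs.Completion

instance isUltrametricDist_KInf (v : Place k) : IsUltrametricDist v.KInf := by
  refine IsUltrametricDist.isUltrametricDist_of_forall_norm_add_le_max_norm fun x y => ?_
  induction x, y using UniformSpace.Completion.induction_on₂ with
  | hp => exact isClosed_le (by fun_prop) (by fun_prop)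
  | ih a b =>
    rw [← UniformSpace.Completion.coe_add, UniformSpace.Completion.norm_coe,
      UniformSpace.Completion.norm_coe, UniformSpace.Completion.norm_coe]
    exact_mod_cast v.abs_add_le_max a.ofAbs b.ofAbs

instance nontriviallyNormedField_KInf (v : Place k) : NontriviallyNormedField v.KInf where
  non_trivial := by
    obtain ⟨x, hx⟩ := v.surj (WithZero.exp 1)
    refine ⟨((WithAbs.toAbs v.abs x : WithAbs v.abs) : v.KInf), ?_⟩
    rw [UniformSpace.Completion.norm_coe, WithAbs.norm_toAbs_eq]
    have h := WithZeroMulInt.toNNReal_strictMono v.one_lt_base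
      (show (1 : ℤᵐ⁰) < v.val x by rw [hx, ← WithZero.exp_zero]; exact WithZero.exp_lt_exp.2 one_pos)
    rw [map_one] at h
    exact_mod_cast h

/-- The norm on the algebraic closure of `k_∞` that extends the norm of `k_∞`. -/
instance normedField_algClosure (v : Place k) : NormedField (AlgebraicClosure v.KInf) :=
  spectralNorm.normedField v.KInf (AlgebraicClosure v.KInf)

instance normedAlgebra_algClosure (v : Place k) :
    NormedAlgebra v.KInf (AlgebraicClosure v.KInf) :=
  spectralNorm.normedAlgebra v.KInf (AlgebraicClosure v.KInf)

/-- `ℂ_∞`, the completion of an algebraic closure of `k_∞`. -/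
abbrev CInf (v : Place k) : Type _ := UniformSpace.Completion (AlgebraicClosure v.KInf)

/-- The embedding `k_∞ → ℂ_∞`. -/
def embInf (v : Place k) : v.KInf →+* v.CInf :=
  (algebraMap (AlgebraicClosure v.KInf) v.CInf).comp
    (algebraMap v.KInf (AlgebraicClosure v.KInf))

/-- The embedding `k → ℂ_∞`. -/
def emb (v : Place k) : k →+* v.CInf :=
  v.embInf.comp (algebraMap k v.KInf)

end Place

section Period

variable (v : Place k) (r : ℕ) [NeZero r]

/-- The last index of an `r`-tuple. -/
def lastIdx : Fin r := ⟨r - 1, Nat.sub_lt (Nat.pos_of_ne_zero (NeZero.ne r)) one_pos⟩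

/-- The Drinfeld period domain of rank `r`: the points of `ℙ^{r-1}(ℂ_∞)` that lie on no
`k_∞`-rational hyperplane. -/
def periodDomain : Set (Projectivization v.CInf (Fin r → v.CInf)) :=
  {z | ∀ c : Fin r → v.KInf, c ≠ 0 → ∑ i, v.embInf (c i) * z.rep i ≠ 0}

variable {v r}

/-- The representative `(z_1, …, z_{r-1}, 1)` of a point `z` of the period domain. -/
def coord (z : Projectivization v.CInf (Fin r → v.CInf)) (i : Fin r) : v.CInf :=
  z.rep i / z.rep (lastIdx r)

/-- The `i`-th imaginary part: the infimum of `|z_i + ∑_{j > i} u_j z_j|_∞` over `u_j ∈ k_∞`,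
where `z_r = 1`. -/
def imPart (z : Projectivization v.CInf (Fin r → v.CInf)) (i : Fin r) : ℝ :=
  ⨅ u : Fin r → v.KInf, ‖coord z i + ∑ j ∈ Finset.Ioi i, v.embInf (u j) * coord z j‖

/-- The total imaginary part: the product of the `i`-th imaginary parts for `1 ≤ i < r`. -/
def totalIm (z : Projectivization v.CInf (Fin r → v.CInf)) : ℝ :=
  ∏ i ∈ Finset.Iio (lastIdx r), imPart z i

/-- The map `(x_1, …, x_r) ↦ x_1 z_1 + ⋯ + x_{r-1} z_{r-1} + x_r` from `k^r` to `ℂ_∞`. -/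
def evalMap (z : Projectivization v.CInf (Fin r → v.CInf)) : (Fin r → k) →+ v.CInf where
  toFun x := ∑ i, v.emb (x i) * coord z i
  map_zero' := by simp
  map_add' x y := by simp [add_mul, Finset.sum_add_distrib]

/-- The lattice `Λ^Y_z`. -/
def lattice (Y : Submodule v.ringAway (Fin r → k))
    (z : Projectivization v.CInf (Fin r → v.CInf)) : AddSubgroup v.CInf :=
  Y.toAddSubgroup.map (evalMap z)

/-- The term of the Eisenstein series at a lattice element `l`: `Im(z)^s / |l|_∞^{rs}`. -/
def eisTerm (z : Projectivization v.CInf (Fin r → v.CInf)) (s : ℂ) (l : v.CInf) : ℂ :=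
  (totalIm z : ℂ) ^ s / (‖l‖ : ℂ) ^ ((r : ℂ) * s)

/-- `E` is the meromorphic continuation of the Eisenstein series `E^Y(z, ·)` to the complex plane:
it is meromorphic on `ℂ`, it is given by the series for `Re s > 1`, and (normal form) it has no
removable singularities, its value at each pole being set to `0`. -/
def IsEisenstein (Y : Submodule v.ringAway (Fin r → k))
    (z : Projectivization v.CInf (Fin r → v.CInf)) (E : ℂ → ℂ) : Prop :=
  MeromorphicNFOn E Set.univ ∧
    ∀ s : ℂ, 1 < s.re → E s = ∑' l : {l : v.CInf // l ∈ lattice Y z ∧ l ≠ 0}, eisTerm z s l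

end Period

/-- The subgroup `a L` of `ℂ_∞`. -/
def mulLattice {v : Place k} (a : k) (L : AddSubgroup v.CInf) : AddSubgroup v.CInf :=
  L.map (AddMonoidHom.mulLeft (v.emb a))

/-- The subgroup `(1/a) L = {w | a w ∈ L}` of `ℂ_∞` (for `a ≠ 0`). -/
def divLattice {v : Place k} (a : k) (L : AddSubgroup v.CInf) : AddSubgroup v.CInf :=
  L.comap (AddMonoidHom.mulLeft (v.emb a))

/-- The quotient `M / L` of subgroups `L ⊆ M` of `ℂ_∞`. -/
abbrev LatQuot {v : Place k} (M L : AddSubgroup v.CInf) : Type _ := M ⧸ L.addSubgroupOf M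

/-- The expression `f(|w|) + ∑ (f(|l - w|) - f(|l|))`, where `l` ranges over the nonzero elements
of `L` with `|l| ≤ |w|`. -/
def bracket {v : Place k} (L : AddSubgroup v.CInf) (f : ℝ → ℂ) (w : v.CInf) : ℂ :=
  f ‖w‖ + ∑ᶠ l ∈ {l : v.CInf | l ∈ L ∧ l ≠ 0 ∧ ‖l‖ ≤ ‖w‖}, (f ‖l - w‖ - f ‖l‖)

/-- The sum of `bracket L f w` over the nonzero classes of `M / L`, where `σ` picks a
representative `w` of each class. -/
def cosetSum {v : Place k} (M L : AddSubgroup v.CInf) (σ : LatQuot M L → M) (f : ℝ → ℂ) : ℂ :=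
  ∑ᶠ c ∈ {c : LatQuot M L | c ≠ 0}, bracket L f (σ c : v.CInf)

end Basic

end DrinfeldEisenstein

end

open DrinfeldEisenstein

/-!
Multiplication by a non-constant `a ∈ A` maps `Λ` into itself with index `|a| ^ r`. If the sum of
`|λ| ^ (-r s)` over `Λ` is split into the cosets of `aΛ`, each coset sum differs from the sum over
`aΛ` only in finitely many terms, since `|λ - w| = |λ|` as soon as `|λ| > |w|`. As the sum over `aΛ`
is `|a| ^ (-r s)` times the sum over `Λ`, the multiple `1 - |a| ^ (r (1 - s))` of the series is a
finite sum of exponentials in `s`. This yields the continuation and its Taylor coefficients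
at `0`; the formula with representatives in `(1 / a)Λ` comes from splitting `(1 / a)Λ` into the
cosets of `Λ` in the same way.

For the index, `A + {|x| ≤ q ^ m} = k` for some `m`, while every `A ∩ {|x| ≤ q ^ m}` is finite, so
that the index of `aY` in `Y` is that of a polydisc in its dilation by `a`. The same index bounds
the number `N(ρ)` of elements of `Λ` of absolute value at most `ρ` by `N(|a| ρ) ≤ |a| ^ r N(ρ)`,
whence the convergence for `Re s > 1`.
-/

noncomputable section

namespace DrinfeldEisenstein

open scoped WithZero NNReal IntermediateField Topology
open WithZero (exp)

section FunctionField

variable {F k : Type*} [Field F] [Field k] [Algebra F k]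

theorem isTranscendenceBasis_of_trdeg_eq_one (htr : Algebra.trdeg F k = 1) {x : k}
    (hx : Transcendental F x) : IsTranscendenceBasis F (fun _ : Unit => x) :=
  (algebraicIndependent_unique_type_iff.2 hx).isTranscendenceBasis_of_lift_trdeg_le_of_finite
    (by simp [htr])

theorem finiteDimensional_adjoin_of_transcendental (hfg : (⊤ : IntermediateField F k).FG)
    (htr : Algebra.trdeg F k = 1) {x : k} (hx : Transcendental F x) :
    FiniteDimensional F⟮x⟯ k := by
  have halg := (isTranscendenceBasis_of_trdeg_eq_one htr hx).isAlgebraic_field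
  rw [Set.range_const] at halg
  have : Algebra.EssFiniteType F k := IntermediateField.fg_top_iff.1 hfg
  have : Algebra.EssFiniteType F⟮x⟯ k := .of_comp F _ _
  exact Algebra.finite_of_essFiniteType_of_isAlgebraic

theorem exists_valuation_one_lt_of_transcendental {x : k} (hx : Transcendental F x) :
    ∃ V : ValuationSubring k, 1 < V.valuation x := by
  obtain ⟨V, -, hxV⟩ := Subring.exists_le_valuationSubring_of_isIntegrallyClosedIn
    (R := (integralClosure F k).toSubring) (x := x) fun h => hx h.isAlgebraic
  exact ⟨V, not_le.1 fun h => hxV ((V.valuation_le_one_iff x).1 h)⟩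

variable {Γ : Type*} [LinearOrderedCommGroupWithZero Γ]

theorem exists_ne_val_eq_of_sum_eq_zero {R ι : Type*} [Ring R] (w : Valuation R Γ) {s : Finset ι}
    {f : ι → R} (h0 : ∑ i ∈ s, f i = 0) (hne : ∃ i ∈ s, w (f i) ≠ 0) :
    ∃ i ∈ s, ∃ j ∈ s, i ≠ j ∧ w (f i) = w (f j) ∧ w (f i) ≠ 0 := by
  classical
  obtain ⟨i₀, hi₀, h⟩ := hne
  obtain ⟨i, hi, hmax⟩ := s.exists_max_image (fun i => w (f i)) ⟨i₀, hi₀⟩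
  have hi0 : w (f i) ≠ 0 := fun h' => h (le_zero_iff.1 (h' ▸ hmax i₀ hi₀))
  by_contra! hc
  refine hi0 ?_
  rw [← w.map_sum_eq_of_lt hi fun j hj => ?_, h0, map_zero]
  rw [Finset.mem_sdiff, Finset.mem_singleton] at hj
  exact lt_of_le_of_ne (hmax j hj.1) fun he => hi0 (hc i hi j hj.1 (Ne.symm hj.2) he.symm)

theorem exists_val_pow_eq_val_algebraMap {E : Type*} [Field E] [Algebra E k] (w : Valuation k Γ)
    {y : k} (hy : IsIntegral E y) (hy0 : y ≠ 0) :
    ∃ n, 0 < n ∧ n ≤ (minpoly E y).natDegree ∧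
      ∃ e : E, e ≠ 0 ∧ w y ^ n = w (algebraMap E k e) := by
  have hsum := minpoly.aeval E y
  simp only [Polynomial.aeval_eq_sum_range, Algebra.smul_def] at hsum
  have hwy : w y ≠ 0 := w.ne_zero_iff.2 hy0
  obtain ⟨i, hi, j, hj, hij, he, hne⟩ := exists_ne_val_eq_of_sum_eq_zero w hsum
    ⟨_, Finset.self_mem_range_succ _, by simp [(minpoly.monic hy).coeff_natDegree, hy0]⟩
  wlog hlt : i < j generalizing i j
  · exact this j hj i hi hij.symm he.symm (he ▸ hne) (by omega)
  set p := minpoly E y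
  have hpj : w (algebraMap E k (p.coeff j)) ≠ 0 := fun h => hne (by rw [he, map_mul, h, zero_mul])
  have hpi : w (algebraMap E k (p.coeff i)) ≠ 0 := fun h => hne (by rw [map_mul, h, zero_mul])
  refine ⟨j - i, by omega, by have := Finset.mem_range.1 hj; omega, p.coeff i / p.coeff j, ?_, ?_⟩
  · exact div_ne_zero (by rintro h; simp [h] at hpi) (by rintro h; simp [h] at hpj)
  · rw [map_div₀, map_div₀, eq_div_iff hpj]
    refine mul_left_cancel₀ (pow_ne_zero i hwy) ?_
    rw [← mul_assoc, ← pow_add, Nat.add_sub_cancel' hlt.le, mul_comm, mul_comm (w y ^ i)]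
    simpa only [map_mul, map_pow] using he.symm

theorem exists_val_eq_zpow_of_mem_adjoin (w : Valuation k Γ) [w.IsTrivialOn F] {x : k}
    (hx : 1 < w x) {y : k} (hy : y ∈ F⟮x⟯) (hy0 : y ≠ 0) : ∃ m : ℤ, w y = w x ^ m := by
  obtain ⟨p, q, rfl⟩ := (IntermediateField.mem_adjoin_simple_iff F y).1 hy
  have hp : p ≠ 0 := by rintro rfl; simp at hy0
  have hq : q ≠ 0 := by rintro rfl; simp at hy0
  refine ⟨p.natDegree - q.natDegree, ?_⟩
  rw [map_div₀,
    Polynomial.valuation_aeval_eq_valuation_X_pow_natDegree_of_one_lt_valuation_X x hx hp,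
    Polynomial.valuation_aeval_eq_valuation_X_pow_natDegree_of_one_lt_valuation_X x hx hq,
    zpow_sub₀ (zero_lt_one.trans hx).ne', zpow_natCast, zpow_natCast]

theorem exists_val_pow_eq_zpow (w : Valuation k Γ) [w.IsTrivialOn F] {x : k}
    (hx : 1 < w x) [FiniteDimensional F⟮x⟯ k] {y : k} (hy0 : y ≠ 0) :
    ∃ m : ℤ, w y ^ (Module.finrank F⟮x⟯ k).factorial = w x ^ m := by
  obtain ⟨n, hn, hdeg, e, he, hye⟩ :=
    exists_val_pow_eq_val_algebraMap w (IsIntegral.of_finite F⟮x⟯ y) hy0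
  obtain ⟨m, hm⟩ := exists_val_eq_zpow_of_mem_adjoin w hx e.2 (by simpa using he)
  obtain ⟨c, hc⟩ := Nat.dvd_factorial hn (hdeg.trans (minpoly.natDegree_le y))
  refine ⟨m * c, ?_⟩
  rw [hc, pow_mul, hye, IntermediateField.algebraMap_apply, hm, zpow_mul, zpow_natCast]

theorem isCyclic_of_pow_eq_zpow {G : Type*} [CommGroup G] [LinearOrder G] [IsOrderedMonoid G]
    {g : G} (hg : 1 < g) {N : ℕ} (hN : N ≠ 0) (h : ∀ y : G, ∃ m : ℤ, y ^ N = g ^ m) :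
    IsCyclic G := by
  choose m hm using h
  have hinj : Function.Injective fun n : ℤ => g ^ n := (zpow_right_strictMono hg).injective
  have hadd (y y' : G) : m (y * y') = m y + m y' :=
    hinj (by simp only [← hm, mul_pow, zpow_add])
  let φ : G →* Multiplicative ℤ :=
    MonoidHom.mk' (fun y => .ofAdd (m y)) fun y y' => congrArg Multiplicative.ofAdd (hadd y y')
  refine isCyclic_of_injective φ fun y y' hyy => pow_left_injective hN ?_
  simp only [hm, show m y = m y' from hyy]

theorem exists_place_of_isCyclic_units {w : Valuation k Γ} (hw : Function.Surjective w)
    {x : k} (hx : 1 < w x) [IsCyclic Γˣ] : ∃ u : Place k, 1 < u.val x := by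
  have : Nontrivial Γˣ := ⟨Units.mk0 (w x) (zero_lt_one.trans hx).ne', 1, fun h => hx.ne' (by
    simpa using congrArg Units.val h)⟩
  obtain ⟨e⟩ := LinearOrderedCommGroup.isCyclic_iff_nonempty_equiv_int.1 ‹IsCyclic Γˣ›
  let e' : Γ ≃*o ℤᵐ⁰ := (OrderMonoidIso.withZeroUnits (α := Γ)).symm.trans e.withZero
  refine ⟨⟨w.map (MonoidWithZeroHom.ofClass e') e'.strictMono.monotone,
    e'.surjective.comp hw⟩, ?_⟩
  simpa only [map_one] using! e'.strictMono hx

theorem exists_place_one_lt [Finite F] (hfg : (⊤ : IntermediateField F k).FG)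
    (htr : Algebra.trdeg F k = 1) {x : k} (hx : Transcendental F x) :
    ∃ u : Place k, 1 < u.val x := by
  obtain ⟨V, hV⟩ := exists_valuation_one_lt_of_transcendental hx
  have := finiteDimensional_adjoin_of_transcendental hfg htr hx
  have : IsCyclic (V.ValueGroup)ˣ := by
    refine isCyclic_of_pow_eq_zpow (g := Units.mk0 (V.valuation x) (zero_lt_one.trans hV).ne')
      (Units.val_lt_val.1 hV) (Module.finrank F⟮x⟯ k).factorial_ne_zero fun γ => ?_
    obtain ⟨y, hy⟩ := V.valuation_surjective γ
    obtain ⟨m, hm⟩ := exists_val_pow_eq_zpow (F := F) V.valuation hV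
      (V.valuation.ne_zero_iff.1 (hy ▸ γ.ne_zero))
    exact ⟨m, Units.ext (by simpa [hy] using hm)⟩
  exact exists_place_of_isCyclic_units V.valuation_surjective hV

end FunctionField

section RegularFunctions

variable {F k : Type*} [Field F] [Field k] [Algebra F k]

theorem transcendental_of_notMem_range (hconst : algebraicClosure F k = ⊥) {x : k}
    (hx : x ∉ Set.range (algebraMap F k)) : Transcendental F x := fun h =>
  hx (IntermediateField.mem_bot.1 (hconst ▸ mem_algebraicClosure_iff.2 h))

namespace Place

theorem mem_ringAway {v : Place k} {x : k} :
    x ∈ v.ringAway ↔ ∀ w : Place k, w ≠ v → w.val x ≤ 1 := by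
  simp only [ringAway, Subring.mem_iInf, Subtype.forall]
  rfl

theorem one_lt_val_of_mem_ringAway [Finite F] (hfg : (⊤ : IntermediateField F k).FG)
    (htr : Algebra.trdeg F k = 1) (hconst : algebraicClosure F k = ⊥) {v : Place k} {a : k}
    (ha : a ∈ v.ringAway) (ha' : a ∉ Set.range (algebraMap F k)) : 1 < v.val a := by
  obtain ⟨u, hu⟩ := exists_place_one_lt hfg htr (transcendental_of_notMem_range hconst ha')
  obtain rfl : u = v := by
    by_contra huv
    exact hu.not_ge (mem_ringAway.1 ha u huv)
  exact hu

theorem mem_ringAway_of_isIntegral {v : Place k} {y : k} (hy : IsIntegral v.ringAway y) :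
    y ∈ v.ringAway := by
  refine mem_ringAway.2 fun w hw => ?_
  have hle : v.ringAway ≤ w.val.integer := fun x hx => mem_ringAway.1 hx w hw
  exact (Valuation.integer.integers w.val).mem_of_integral <|
    hy.map_of_comp_eq (Subring.inclusion hle) (RingHom.id k) rfl

theorem adjoin_le_ringAway [Finite F] {v : Place k} {a : k} (ha : a ∈ v.ringAway) :
    (Algebra.adjoin F {a}).toSubring ≤ v.ringAway := fun x hx => by
  refine mem_ringAway.2 fun w hw => ?_
  refine Algebra.adjoin_induction (p := fun z _ => z ∈ w.val.valuationSubring) ?_ ?_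
    (fun _ _ _ _ => add_mem) (fun _ _ _ _ => mul_mem) hx
  · rintro z rfl
    exact mem_ringAway.1 ha w hw
  · exact fun c => FiniteField.valuation_algebraMap_le_one w.val c

theorem exists_mul_mem_ringAway [Finite F] (htr : Algebra.trdeg F k = 1) {v : Place k} {a : k}
    (ha : a ∈ v.ringAway) (hta : Transcendental F a) (y : k) :
    ∃ d ∈ Algebra.adjoin F {a}, d ≠ 0 ∧ d * y ∈ v.ringAway := by
  have halg := (isTranscendenceBasis_of_trdeg_eq_one htr hta).isAlgebraic
  rw [Set.range_const] at halg
  obtain ⟨d, hd, hdy⟩ :=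
    (Algebra.IsAlgebraic.isAlgebraic (R := Algebra.adjoin F {a}) y).exists_integral_multiple
  exact ⟨d, d.2, by simpa using hd, mem_ringAway_of_isIntegral <|
    hdy.map_of_comp_eq (Subring.inclusion (adjoin_le_ringAway ha)) (RingHom.id k) rfl⟩

theorem isFractionRing_ringAway {v : Place k}
    (h : ∀ y : k, ∃ d ∈ v.ringAway, d ≠ 0 ∧ d * y ∈ v.ringAway) :
    IsFractionRing v.ringAway k := by
  refine IsFractionRing.of_field _ _ fun y => ?_
  obtain ⟨d, hd, hd0, hdy⟩ := h y
  exact ⟨⟨d * y, hdy⟩, ⟨d, hd⟩, (mul_div_cancel_left₀ y hd0).symm⟩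

/-- The closed ball `{x | |x|_v ≤ q_v ^ m}` of `k`, as an additive group; its radius is recorded by
the exponent `m`. -/
def ball (v : Place k) (m : ℤ) : AddSubgroup k := v.val.leAddSubgroup (exp m)

theorem mem_ball {v : Place k} {m : ℤ} {x : k} : x ∈ v.ball m ↔ v.val x ≤ exp m := Iff.rfl

theorem ball_mono (v : Place k) : Monotone v.ball := fun _ _ h =>
  v.val.leAddSubgroup_monotone (WithZero.exp_le_exp.2 h)

theorem exists_mem_ball (v : Place k) (x : k) : ∃ m, x ∈ v.ball m := by
  obtain rfl | hx := eq_or_ne x 0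
  · exact ⟨0, zero_mem _⟩
  · exact ⟨WithZero.log (v.val x), by rw [mem_ball, WithZero.exp_log (v.val.ne_zero_iff.2 hx)]⟩

theorem mul_mem_ball_add {v : Place k} {m n : ℤ} {x y : k} (hx : x ∈ v.ball m) (hy : y ∈ v.ball n) :
    x * y ∈ v.ball (m + n) := by
  rw [mem_ball, map_mul, WithZero.exp_add]
  exact mul_le_mul' hx hy

theorem ne_zero_of_val_eq_exp {v : Place k} {c : k} {n : ℤ} (hc : v.val c = exp n) : c ≠ 0 :=
  v.val.ne_zero_iff.1 (hc ▸ WithZero.exp_ne_zero)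

theorem map_mulLeft_ball {v : Place k} {c : k} {n : ℤ} (hc : v.val c = exp n) (m : ℤ) :
    (v.ball m).map (AddMonoidHom.mulLeft c) = v.ball (m + n) := by
  have hinv : v.val c⁻¹ = exp (-n) := by rw [map_inv₀, hc, WithZero.exp_neg]
  ext x
  simp only [AddSubgroup.mem_map, AddMonoidHom.coe_mulLeft]
  constructor
  · rintro ⟨y, hy, rfl⟩
    rw [add_comm]
    exact mul_mem_ball_add (mem_ball.2 hc.le) hy
  · refine fun hx => ⟨c⁻¹ * x, ?_, mul_inv_cancel_left₀ (ne_zero_of_val_eq_exp hc) x⟩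
    simpa using mul_mem_ball_add (mem_ball.2 hinv.le) hx

theorem relIndex_ball_neg_one_zero (v : Place k) : (v.ball (-1)).relIndex (v.ball 0) = v.q := by
  let e : v.ball 0 ≃+ v.val.valuationSubring :=
    { toFun := fun x => ⟨x, mem_ball.1 x.2⟩
      invFun := fun x => ⟨x, mem_ball.2 x.2⟩
      map_add' := fun _ _ => rfl }
  refine Nat.card_congr (QuotientAddGroup.congr _
    (IsLocalRing.maximalIdeal v.val.valuationSubring).toAddSubgroup e ?_).toEquiv
  ext x
  refine (AddSubgroup.mem_map_equiv (f := e)).trans ?_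
  change v.val (x : k) ≤ exp (-1) ↔ x ∈ IsLocalRing.maximalIdeal v.val.valuationSubring
  rw [Valuation.mem_maximalIdeal_iff]
  by_cases hx : v.val (x : k) = 0
  · simp [hx]
  · rw [← WithZero.exp_log hx, ← WithZero.exp_zero, WithZero.exp_le_exp, WithZero.exp_lt_exp]
    omega

theorem relIndex_ball_succ (v : Place k) (m : ℤ) :
    (v.ball m).relIndex (v.ball (m + 1)) = v.q := by
  obtain ⟨c, hc⟩ := v.surj (exp (m + 1))
  rw [show m = -1 + (m + 1) by ring, ← map_mulLeft_ball hc, show -1 + (m + 1) + 1 = 0 + (m + 1) by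
    ring, ← map_mulLeft_ball hc, AddSubgroup.relIndex_map_map_of_injective _ _
    (mul_right_injective₀ (ne_zero_of_val_eq_exp hc)), relIndex_ball_neg_one_zero]

theorem relIndex_ball_add (v : Place k) (m : ℤ) (n : ℕ) :
    (v.ball m).relIndex (v.ball (m + n)) = v.q ^ n := by
  induction n with
  | zero => simp
  | succ n ih =>
    rw [← AddSubgroup.relIndex_mul_relIndex _ _ _ (v.ball_mono (show m ≤ m + n by omega))
      (v.ball_mono (by push_cast; omega)), ih, pow_succ, Nat.cast_succ, ← add_assoc,
      relIndex_ball_succ]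

end Place

end RegularFunctions

section Approximation

variable {F k : Type*} [Field F] [Field k] [Algebra F k]
  {Γ : Type*} [LinearOrderedCommGroupWithZero Γ]

theorem exists_val_sub_aeval_lt_one (w : Valuation k Γ) [w.IsTrivialOn F] {a : k}
    (ha : 1 < w a) {g : k} (hg : g ∈ F⟮a⟯) :
    ∃ P : Polynomial F, w (g - Polynomial.aeval a P) < 1 := by
  obtain ⟨p, q, rfl⟩ := (IntermediateField.mem_adjoin_simple_iff F g).1 hg
  by_cases hq : q = 0
  · exact ⟨0, by simp [hq]⟩
  have hwq := Polynomial.valuation_aeval_eq_valuation_X_pow_natDegree_of_one_lt_valuation_X a ha hq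
  have hwq0 : 0 < w (Polynomial.aeval a q) := hwq ▸ pow_pos (zero_lt_one.trans ha) _
  have hq0 : Polynomial.aeval a q ≠ 0 := w.ne_zero_iff.1 hwq0.ne'
  have hsub : Polynomial.aeval a p / Polynomial.aeval a q - Polynomial.aeval a (p / q) =
      Polynomial.aeval a (p % q) / Polynomial.aeval a q := by
    rw [eq_div_iff hq0, sub_mul, div_mul_cancel₀ _ hq0, ← map_mul, ← map_sub, mul_comm,
      ← EuclideanDomain.mod_eq_sub_mul_div]
  refine ⟨p / q, ?_⟩
  rw [hsub, map_div₀, div_lt_one₀ hwq0]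
  by_cases hr : p % q = 0
  · rwa [hr, map_zero, map_zero]
  · rw [hwq, Polynomial.valuation_aeval_eq_valuation_X_pow_natDegree_of_one_lt_valuation_X a ha hr]
    exact pow_lt_pow_right₀ ha
      (Polynomial.natDegree_lt_natDegree hr (Polynomial.degree_mod_lt p hq))

theorem exists_val_sub_algebraMap_lt_one (w : Valuation k Γ) [w.IsTrivialOn F] {a : k}
    (ha : 1 < w a) {g : k} (hg : g ∈ F⟮a⟯) (hg1 : w g ≤ 1) :
    ∃ c : F, w (g - algebraMap F k c) < 1 := by
  obtain ⟨P, hP⟩ := exists_val_sub_aeval_lt_one w ha hg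
  have hP1 : w (Polynomial.aeval a P) ≤ 1 := by
    rw [← sub_sub_cancel g (Polynomial.aeval a P)]
    exact w.map_sub_le hg1 hP.le
  have hdeg : P.natDegree = 0 := by
    by_contra hdeg
    have hP0 : P ≠ 0 := by rintro rfl; exact hdeg Polynomial.natDegree_zero
    rw [Polynomial.valuation_aeval_eq_valuation_X_pow_natDegree_of_one_lt_valuation_X a ha hP0]
      at hP1
    exact hP1.not_gt (one_lt_pow₀ ha hdeg)
  rw [Polynomial.eq_C_of_natDegree_eq_zero hdeg, Polynomial.aeval_C] at hP
  exact ⟨_, hP⟩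

theorem linearIndependent_adjoin_of_val_sum_lt_one (w : Valuation k Γ) [w.IsTrivialOn F] {a : k}
    (ha : 1 < w a) {ι : Type*} [Fintype ι] {u : ι → k} (hu : ∀ i, w (u i) ≤ 1)
    (hres : ∀ c : ι → F, w (∑ i, algebraMap F k (c i) * u i) < 1 → c = 0) :
    LinearIndependent F⟮a⟯ u := by
  by_contra hdep
  obtain ⟨g, hsum, i₀, hgi₀⟩ := Fintype.not_linearIndependent_iff.1 hdep
  obtain ⟨i, -, hmax⟩ := Finset.univ.exists_max_image (fun i => w (g i : k))
    ⟨i₀, Finset.mem_univ _⟩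
  have hgi : (g i : k) ≠ 0 := fun h => hgi₀ <| by
    simpa [h] using hmax i₀ (Finset.mem_univ _)
  have hle (j) : w ((g j / g i : F⟮a⟯) : k) ≤ 1 := by
    rw [IntermediateField.coe_div, map_div₀]
    exact (div_le_one₀ (zero_lt_iff.2 (w.ne_zero_iff.2 hgi))).2 (hmax j (Finset.mem_univ _))
  choose c hc using fun j => exists_val_sub_algebraMap_lt_one w ha (g j / g i).2 (hle j)
  have hnormalized : ∑ j, ((g j / g i : F⟮a⟯) : k) * u j = 0 := by
    simp only [IntermediateField.coe_div, div_mul_eq_mul_div, ← Finset.sum_div]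
    simp only [Algebra.smul_def, IntermediateField.algebraMap_apply] at hsum
    rw [hsum, zero_div]
  have hlt : w (∑ j, algebraMap F k (c j) * u j) < 1 := by
    rw [← Valuation.map_neg, ← zero_sub, ← hnormalized, ← Finset.sum_sub_distrib]
    refine w.map_sum_lt one_ne_zero fun j _ => ?_
    rw [← sub_mul, map_mul]
    exact mul_lt_one_of_lt_of_le (hc j) (hu j)
  have hci := hc i
  rw [hres c hlt, Pi.zero_apply, map_zero, sub_zero, IntermediateField.coe_div, div_self hgi,
    map_one] at hci
  exact hci.false

end Approximation

section Completeness

variable {F k : Type*} [Field F] [Field k] [Algebra F k]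

namespace Place

theorem finite_residueField [Finite F] (v : Place k) {a : k} (ha : 1 < v.val a)
    [FiniteDimensional F⟮a⟯ k] : Finite (IsLocalRing.ResidueField v.val.valuationSubring) := by
  let O := v.val.valuationSubring
  let f : F →+* O := (algebraMap F k).codRestrict O
    fun c => FiniteField.valuation_algebraMap_le_one v.val c
  let : Algebra F (IsLocalRing.ResidueField O) := ((IsLocalRing.residue O).comp f).toAlgebra
  have hrank : Module.rank F (IsLocalRing.ResidueField O) ≤ Module.finrank F⟮a⟯ k := by
    refine rank_le fun s hs => ?_
    choose u hu using IsLocalRing.residue_surjective (R := O)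
    rw [← Fintype.card_coe]
    refine (linearIndependent_adjoin_of_val_sum_lt_one v.val ha (u := fun i : s => (u i : k))
      (fun i => (u i).2) fun c hc => ?_).fintype_card_le_finrank
    refine funext (Fintype.linearIndependent_iff.1 hs c ?_)
    have hmem : (∑ i : s, f (c i) * u i : O) ∈ IsLocalRing.maximalIdeal O := by
      rw [Valuation.mem_maximalIdeal_iff]
      convert hc
      push_cast
      rfl
    rw [← IsLocalRing.residue_eq_zero_iff, map_sum] at hmem
    simpa only [map_mul, hu, Algebra.smul_def] using! hmem
  have : Module.Finite F (IsLocalRing.ResidueField O) :=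
    Module.rank_lt_aleph0_iff.1 (hrank.trans_lt (Cardinal.natCast_lt_aleph0))
  exact Module.finite_of_finite F

theorem two_le_q (v : Place k) [Finite (IsLocalRing.ResidueField v.val.valuationSubring)] :
    2 ≤ v.q := Finite.one_lt_card

theorem base_eq_q (v : Place k) [Finite (IsLocalRing.ResidueField v.val.valuationSubring)] :
    v.base = v.q := max_eq_right (by exact_mod_cast v.two_le_q)

theorem abs_eq_zpow (v : Place k) {x : k} {n : ℤ} (hx : v.val x = exp n) :
    v.abs x = (v.base : ℝ) ^ n := by
  change ((WithZeroMulInt.toNNReal v.one_lt_base.ne_zero (v.val x) : ℝ≥0) : ℝ) = _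
  rw [hx, WithZeroMulInt.toNNReal_neg_apply _ WithZero.exp_ne_zero]
  simp [WithZero.exp]

theorem abs_le_zpow_iff (v : Place k) {x : k} {n : ℤ} :
    v.abs x ≤ (v.base : ℝ) ^ n ↔ x ∈ v.ball n := by
  have hbase : (1 : ℝ) < v.base := by exact_mod_cast v.one_lt_base
  obtain rfl | hx := eq_or_ne x 0
  · simp only [map_zero, zero_mem, iff_true]
    positivity
  · have hlog := WithZero.exp_log (v.val.ne_zero_iff.2 hx)
    rw [v.abs_eq_zpow hlog.symm, zpow_le_zpow_iff_right₀ hbase, mem_ball, ← hlog,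
      WithZero.exp_le_exp, WithZero.log_exp]

theorem exists_sup_ball_eq_top [Finite F] {v : Place k} {a : k} (ha : a ∈ v.ringAway)
    (ha1 : 1 < v.val a) [FiniteDimensional F⟮a⟯ k]
    (hfrac : ∀ y : k, ∃ d ∈ Algebra.adjoin F {a}, d ≠ 0 ∧ d * y ∈ v.ringAway) :
    ∃ m, v.ringAway.toAddSubgroup ⊔ v.ball m = ⊤ := by
  let b := Module.finBasis F⟮a⟯ k
  choose d hd hd0 hdb using fun i => hfrac (b i)
  choose m hm using fun i => v.exists_mem_ball (d i * b i)
  obtain ⟨M, hM⟩ := Finset.exists_le (Finset.univ.image m)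
  refine ⟨M, eq_top_iff.2 fun x _ => ?_⟩
  have hmem (i) : (b.repr x i : k) / d i ∈ F⟮a⟯ :=
    div_mem (b.repr x i).2 (IntermediateField.algebra_adjoin_le_adjoin F _ (hd i))
  choose P hP using fun i => exists_val_sub_aeval_lt_one v.val ha1 (hmem i)
  have hx : x = ∑ i, Polynomial.aeval a (P i) * (d i * b i) +
      ∑ i, ((b.repr x i : k) / d i - Polynomial.aeval a (P i)) * (d i * b i) := by
    nth_rw 1 [← b.sum_repr x]
    rw [← Finset.sum_add_distrib]
    refine Finset.sum_congr rfl fun i _ => ?_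
    rw [Algebra.smul_def, IntermediateField.algebraMap_apply, ← add_mul, add_sub_cancel,
      ← mul_assoc, div_mul_cancel₀ _ (hd0 i)]
  rw [hx]
  refine AddSubgroup.add_mem_sup (sum_mem fun i _ => ?_) (sum_mem fun i _ => ?_)
  · exact v.ringAway.mul_mem (adjoin_le_ringAway (F := F) ha
      (Algebra.adjoin_singleton_eq_range_aeval F a ▸ ⟨P i, rfl⟩)) (hdb i)
  · have := mul_mem_ball_add (m := 0) (mem_ball.2 (hP i).le) (hm i)
    rw [zero_add] at this
    exact v.ball_mono (hM (m i) (Finset.mem_image_of_mem _ (Finset.mem_univ _))) this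

theorem finite_ringAway_inf_ball [Finite F] (hfg : (⊤ : IntermediateField F k).FG)
    (htr : Algebra.trdeg F k = 1) (hconst : algebraicClosure F k = ⊥) (v : Place k)
    [Finite (IsLocalRing.ResidueField v.val.valuationSubring)] (m : ℤ) :
    Finite (v.ringAway.toAddSubgroup ⊓ v.ball m : AddSubgroup k) := by
  have hnat (n : ℕ) : Finite (v.ball n ⊓ v.ringAway.toAddSubgroup : AddSubgroup k) := by
    induction n with
    | zero =>
      refine Set.Finite.subset (Set.finite_range (algebraMap F k)) fun x hx => ?_
      by_contra hxF
      have hle : v.val x ≤ 1 := by simpa [mem_ball] using hx.1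
      exact hle.not_gt (one_lt_val_of_mem_ringAway hfg htr hconst hx.2 hxF)
    | succ n ih =>
      refine Nat.finite_of_card_ne_zero ?_
      rw [← AddSubgroup.relIndex_bot_left, ← AddSubgroup.relIndex_mul_relIndex _ _ _ bot_le
        (inf_le_inf_right _ (v.ball_mono (show (n : ℤ) ≤ (n + 1 : ℕ) by omega))),
        AddSubgroup.relIndex_bot_left]
      refine mul_ne_zero Nat.card_pos.ne' (AddSubgroup.relIndex_inter_ne_zero ?_ _)
      rw [Nat.cast_succ, relIndex_ball_succ]
      exact (zero_lt_two.trans_le v.two_le_q).ne'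
  have := hnat m.toNat
  exact Set.Finite.subset this fun x hx => ⟨v.ball_mono (Int.self_le_toNat m) hx.2, hx.1⟩

end Place

end Completeness

section Index

theorem card_inf_mul_relIndex {G : Type*} [AddCommGroup G] {H K M : AddSubgroup G} (hHK : H ≤ K)
    (hM : H ⊔ M = ⊤) :
    Nat.card (H ⊓ M : AddSubgroup G) * H.relIndex K = Nat.card (K ⊓ M : AddSubgroup G) := by
  have hsup : K ⊓ M ⊔ H = K := by rw [inf_sup_assoc_of_le M hHK, sup_comm M, hM, inf_top_eq]
  have hinf : H ⊓ (K ⊓ M) = H ⊓ M := by rw [← inf_assoc, inf_eq_left.2 hHK]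
  have hrel : H.relIndex K = H.relIndex (K ⊓ M ⊔ H) := by rw [hsup]
  rw [hrel, AddSubgroup.relIndex_sup_right, ← AddSubgroup.inf_relIndex_right, hinf,
    ← AddSubgroup.relIndex_bot_left, ← AddSubgroup.relIndex_bot_left,
    AddSubgroup.relIndex_mul_relIndex _ _ _ bot_le (inf_le_inf_right _ hHK)]

theorem relIndex_eq_relIndex_of_sup_eq_top {G : Type*} [AddCommGroup G] {Y Y' B B' : AddSubgroup G}
    (hY : Y' ≤ Y) (hB : B ≤ B') (h : Y ⊔ B = ⊤) (h' : Y' ⊔ B' = ⊤)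
    [Finite (Y ⊓ B : AddSubgroup G)]
    (hcard : Nat.card (Y' ⊓ B' : AddSubgroup G) = Nat.card (Y ⊓ B : AddSubgroup G)) :
    Y'.relIndex Y = B.relIndex B' := by
  have hYB' : Nat.card (Y' ⊓ B' : AddSubgroup G) * Y'.relIndex Y =
      Nat.card (Y ⊓ B' : AddSubgroup G) := card_inf_mul_relIndex hY h'
  have hBY : Nat.card (B ⊓ Y : AddSubgroup G) * B.relIndex B' =
      Nat.card (B' ⊓ Y : AddSubgroup G) := card_inf_mul_relIndex hB (sup_comm B Y ▸ h)
  rw [inf_comm B Y, inf_comm B' Y, ← hYB', hcard] at hBY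
  exact (Nat.eq_of_mul_eq_mul_left Nat.card_pos hBY).symm

theorem relIndex_pi_const {G ι : Type*} [AddGroup G] [Fintype ι] (H K : AddSubgroup G) :
    (AddSubgroup.pi Set.univ fun _ : ι => H).relIndex (AddSubgroup.pi Set.univ fun _ : ι => K) =
      H.relIndex K ^ Fintype.card ι := by
  let f : AddSubgroup.pi Set.univ (fun _ : ι => K) →+ (ι → K) :=
    { toFun := fun x i => ⟨x.1 i, x.2 i trivial⟩
      map_zero' := rfl
      map_add' := fun _ _ => rfl }
  have hf : Function.Surjective f := fun y => ⟨⟨fun i => y i, fun i _ => (y i).2⟩, rfl⟩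
  have hcomap : (AddSubgroup.pi Set.univ fun _ : ι => H).addSubgroupOf _ =
      (AddSubgroup.pi Set.univ fun _ : ι => H.addSubgroupOf K).comap f := rfl
  rw [AddSubgroup.relIndex, hcomap, AddSubgroup.index_comap_of_surjective _ hf,
    AddSubgroup.index_pi, Finset.prod_const, Finset.card_univ, AddSubgroup.relIndex]

end Index

section Projective

variable {R M : Type*} [CommRing R] [IsDomain R] [AddCommGroup M] [Module R M]

theorem exists_linearIndependent_smul_mem_span (h : Module.finrank R M ≠ 0) :
    ∃ b : Fin (Module.finrank R M) → M, LinearIndependent R b ∧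
      ∀ y, ∃ d : R, d ≠ 0 ∧ d • y ∈ Submodule.span R (Set.range b) := by
  have hrank : Module.rank R M = Module.finrank R M := by
    refine (Cardinal.cast_toNat_of_lt_aleph0 (not_le.1 fun hinf => h ?_)).symm
    exact Cardinal.toNat_apply_of_aleph0_le hinf
  obtain ⟨b, hb⟩ := exists_linearIndependent_of_le_finrank (le_refl (Module.finrank R M))
  refine ⟨b, hb, fun y => ?_⟩
  have hcard : Cardinal.mk (Set.range b) = Module.finrank R M := by
    classical
    rw [Cardinal.mk_fintype, Set.card_range_of_injective hb.injective, Fintype.card_fin]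
  have hquot : Module.rank R (M ⧸ Submodule.span R (Set.range b)) = 0 := by
    have hadd := rank_quotient_add_rank_of_isDomain (Submodule.span R (Set.range b))
    rw [hrank, rank_span hb, hcard] at hadd
    exact Cardinal.eq_of_add_eq_add_right (hadd.trans (zero_add _).symm) Cardinal.natCast_lt_aleph0
  obtain ⟨d, hd, hdy⟩ := rank_eq_zero_iff.1 hquot (Submodule.Quotient.mk y)
  exact ⟨d, hd, (Submodule.Quotient.mk_eq_zero _).1 hdy⟩

theorem module_finite_of_projective_of_finrank_ne_zero [Module.Projective R M]
    (h : Module.finrank R M ≠ 0) : Module.Finite R M := by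
  classical
  obtain ⟨s, hs⟩ := Module.projective_def'.1 ‹Module.Projective R M›
  obtain ⟨b, -, hb⟩ := exists_linearIndependent_smul_mem_span h
  let S : Finset M := Finset.univ.biUnion fun i => (s (b i)).support
  have hspan : Submodule.span R (Set.range b) ≤ (Finsupp.supported R R (S : Set M)).comap s := by
    refine Submodule.span_le.2 ?_
    rintro _ ⟨i, rfl⟩ y hy
    exact Finset.mem_coe.2 (Finset.mem_biUnion.2 ⟨i, Finset.mem_univ _, hy⟩)
  have hsupp : ∀ y, s y ∈ Finsupp.supported R R (S : Set M) := by
    intro y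
    obtain ⟨d, hd, hdy⟩ := hb y
    have hdsy : d • s y ∈ Finsupp.supported R R (S : Set M) := map_smul s d y ▸ hspan hdy
    exact fun i hi => hdsy (by simpa [hd] using hi)
  refine ⟨S, eq_top_iff.2 fun y _ => ?_⟩
  have hy : Finsupp.linearCombination R id (s y) = y := LinearMap.congr_fun hs y
  rw [← hy, Finsupp.linearCombination_apply]
  exact Submodule.sum_mem _ fun i hi => Submodule.smul_mem _ _ (Submodule.subset_span (hsupp y hi))

theorem exists_ne_zero_forall_isInteger_of_finite {K ι : Type*} [Field K] [Algebra R K]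
    [IsFractionRing R K] [Finite ι] (Y : Submodule R (ι → K)) [Module.Finite R Y] :
    ∃ d : R, d ≠ 0 ∧ ∀ y ∈ Y, ∀ i, IsLocalization.IsInteger R (d • y i) := by
  have := Fintype.ofFinite ι
  obtain ⟨S, hS⟩ := Module.Finite.iff_fg.1 ‹Module.Finite R Y›
  obtain ⟨d, hd⟩ := IsLocalization.exist_integer_multiples (nonZeroDivisors R)
    (S ×ˢ (Finset.univ : Finset ι)) fun p => p.1 p.2
  refine ⟨d, nonZeroDivisors.coe_ne_zero d, fun y hy i => ?_⟩
  rw [← hS] at hy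
  induction hy using Submodule.span_induction with
  | mem y hy => exact hd (y, i) (Finset.mk_mem_product hy (Finset.mem_univ i))
  | zero => exact (smul_zero (d : R) : _ = (0 : K)).symm ▸ IsLocalization.isInteger_zero
  | add x y _ _ hx hy =>
    exact (smul_add (d : R) (x i) (y i)).symm ▸ IsLocalization.isInteger_add hx hy
  | smul c x _ hx => exact (smul_comm (d : R) c (x i)).symm ▸ IsLocalization.isInteger_smul hx

end Projective

section PiBall

variable {k ι : Type*} [Field k]

namespace Place

/-- The tuples with coordinates in `v.ball m`: the ball in `k^ι` for the maximum norm. -/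
def piBall (v : Place k) (ι : Type*) (m : ℤ) : AddSubgroup (ι → k) :=
  AddSubgroup.pi Set.univ fun _ => v.ball m

theorem mem_piBall {v : Place k} {m : ℤ} {x : ι → k} : x ∈ v.piBall ι m ↔ ∀ i, x i ∈ v.ball m := by
  simp [piBall, AddSubgroup.mem_pi]

theorem piBall_mono (v : Place k) : Monotone (v.piBall ι) :=
  fun _ _ h _ hx => mem_piBall.2 fun i => v.ball_mono h (mem_piBall.1 hx i)

theorem relIndex_piBall [Fintype ι] (v : Place k) (m : ℤ) (n : ℕ) :
    (v.piBall ι m).relIndex (v.piBall ι (m + n)) = (v.q ^ n) ^ Fintype.card ι := by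
  rw [piBall, piBall, relIndex_pi_const, relIndex_ball_add]

theorem map_smul_piBall {v : Place k} {c : k} {n : ℤ} (hc : v.val c = exp n) (m : ℤ) :
    (v.piBall ι m).map (DistribSMul.toAddMonoidHom (ι → k) c) = v.piBall ι (m + n) := by
  have hball : ∀ x : k, x ∈ v.ball (m + n) ↔ ∃ y ∈ v.ball m, c * y = x := fun x => by
    rw [← map_mulLeft_ball hc]; rfl
  ext x
  simp only [AddSubgroup.mem_map, mem_piBall, hball]
  constructor
  · rintro ⟨y, hy, rfl⟩ i
    exact ⟨y i, hy i, rfl⟩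
  · intro hx
    choose y hy hxy using hx
    exact ⟨y, hy, funext hxy⟩

variable {v : Place k}

theorem exists_forall_mem_piBall [Finite ι] {κ : Type*} [Finite κ] (b : κ → ι → k) :
    ∃ N, ∀ i, b i ∈ v.piBall ι N := by
  choose n hn using fun p : κ × ι => v.exists_mem_ball (b p.1 p.2)
  obtain ⟨N, hN⟩ := (Set.finite_range n).bddAbove
  exact ⟨N, fun i => mem_piBall.2 fun j => v.ball_mono (hN ⟨(i, j), rfl⟩) (hn (i, j))⟩

variable (Y : Submodule v.ringAway (ι → k))

theorem finite_inf_piBall [IsFractionRing v.ringAway k] [Finite ι] [Module.Finite v.ringAway Y]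
    (hA : ∀ m, Finite (v.ringAway.toAddSubgroup ⊓ v.ball m : AddSubgroup k)) (m : ℤ) :
    Finite (Y.toAddSubgroup ⊓ v.piBall ι m : AddSubgroup (ι → k)) := by
  obtain ⟨d, hd, hdY⟩ := exists_ne_zero_forall_isInteger_of_finite Y
  have hdA : ∀ y ∈ Y, ∀ i, (d : k) * y i ∈ v.ringAway := fun y hy i => by
    obtain ⟨c, hc⟩ := hdY y hy i
    exact (show (c : k) = d * y i from hc) ▸ c.2
  obtain ⟨n, hn⟩ := v.exists_mem_ball (d : k)
  have := hA (n + m)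
  refine Finite.of_injective
    (fun y : (Y.toAddSubgroup ⊓ v.piBall ι m : AddSubgroup (ι → k)) => fun i : ι =>
      (⟨d * (y : ι → k) i, hdA _ y.2.1 i, mul_mem_ball_add hn (mem_piBall.1 y.2.2 i)⟩ :
        (v.ringAway.toAddSubgroup ⊓ v.ball (n + m) : AddSubgroup k))) fun x y h => ?_
  ext i
  exact mul_left_cancel₀ (Subtype.coe_ne_coe.2 hd) (congrArg Subtype.val (congrFun h i))

variable [Fintype ι]

theorem relIndex_map_smul (hY : ∃ m, Y.toAddSubgroup ⊔ v.piBall ι m = ⊤)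
    (hfin : ∀ m, Finite (Y.toAddSubgroup ⊓ v.piBall ι m : AddSubgroup (ι → k)))
    {a : k} (ha : a ∈ v.ringAway) {n : ℕ} (han : v.val a = exp (n : ℤ)) :
    (Y.toAddSubgroup.map (DistribSMul.toAddMonoidHom (ι → k) a)).relIndex
      Y.toAddSubgroup = (v.q ^ n) ^ Fintype.card ι := by
  have ha0 : a ≠ 0 := ne_zero_of_val_eq_exp han
  have hinj : Function.Injective (DistribSMul.toAddMonoidHom (ι → k) a) :=
    smul_right_injective _ ha0
  have hsurj : Function.Surjective (DistribSMul.toAddMonoidHom (ι → k) a) :=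
    fun x => ⟨a⁻¹ • x, smul_inv_smul₀ ha0 x⟩
  obtain ⟨m, hm⟩ := hY
  have := hfin m
  rw [relIndex_eq_relIndex_of_sup_eq_top (B := v.piBall ι m) (B' := v.piBall ι (m + n)) ?_
    (v.piBall_mono (by omega)) hm, relIndex_piBall]
  · rw [← map_smul_piBall han, ← AddSubgroup.map_sup, hm,
      AddSubgroup.map_top_of_surjective _ hsurj]
  · rw [← map_smul_piBall han, ← AddSubgroup.map_inf _ _ _ hinj]
    exact (Nat.card_congr (AddSubgroup.equivMapOfInjective _ _ hinj).toEquiv).symm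
  · rintro _ ⟨y, hy, rfl⟩
    exact Y.smul_mem ⟨a, ha⟩ hy

variable [IsFractionRing v.ringAway k]

theorem exists_sup_piBall_eq_top [Nonempty ι]
    (hrank : Module.finrank v.ringAway Y = Fintype.card ι)
    (hA : ∃ m, v.ringAway.toAddSubgroup ⊔ v.ball m = ⊤) :
    ∃ m, Y.toAddSubgroup ⊔ v.piBall ι m = ⊤ := by
  obtain ⟨m, hm⟩ := hA
  obtain ⟨b, hb, -⟩ := exists_linearIndependent_smul_mem_span (hrank ▸ Fintype.card_ne_zero)
  have hbk : LinearIndependent k fun i => (b i : ι → k) :=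
    (LinearIndependent.iff_fractionRing v.ringAway k).1
      (hb.map' Y.subtype (Submodule.ker_subtype Y))
  have : Nonempty (Fin (Module.finrank v.ringAway Y)) :=
    Fin.pos_iff_nonempty.1 (hrank ▸ Fintype.card_pos)
  let e := basisOfLinearIndependentOfCardEqFinrank hbk (by simp [hrank])
  obtain ⟨N, hN⟩ := exists_forall_mem_piBall fun i => (b i : ι → k)
  refine ⟨m + N, eq_top_iff.2 fun x _ => ?_⟩
  choose α hα β hβ hαβ using fun i =>
    AddSubgroup.mem_sup.1 (hm ▸ AddSubgroup.mem_top (e.repr x i) :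
      e.repr x i ∈ v.ringAway.toAddSubgroup ⊔ v.ball m)
  have hx : ∑ i, α i • (b i : ι → k) + ∑ i, β i • (b i : ι → k) = x := by
    rw [← Finset.sum_add_distrib]
    conv_rhs => rw [← e.sum_repr x]
    exact Finset.sum_congr rfl fun i _ => by
      rw [← hαβ, add_smul, coe_basisOfLinearIndependentOfCardEqFinrank]
  rw [← hx]
  refine AddSubgroup.add_mem_sup (sum_mem fun i _ => ?_) (sum_mem fun i _ => ?_)
  · exact Y.smul_mem ⟨α i, hα i⟩ (b i).2
  · exact mem_piBall.2 fun j => mul_mem_ball_add (hβ i) (mem_piBall.1 (hN i) j)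

end Place

end PiBall

section StronglyDiscrete

/-- A subgroup of a seminormed group is strongly discrete (Goss) if every ball contains only
finitely many of its elements. -/
def IsStronglyDiscrete {G : Type*} [SeminormedAddGroup G] (L : AddSubgroup G) : Prop :=
  ∀ ρ : ℝ, {l | l ∈ L ∧ ‖l‖ ≤ ρ}.Finite

theorem IsStronglyDiscrete.mono {G : Type*} [SeminormedAddGroup G] {L M : AddSubgroup G}
    (hM : IsStronglyDiscrete M) (hLM : L ≤ M) : IsStronglyDiscrete L :=
  fun ρ => (hM ρ).subset fun _ hl => ⟨hLM hl.1, hl.2⟩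

end StronglyDiscrete

section Period

variable {k : Type*} [Field k]

namespace Place

theorem norm_embInf (v : Place k) (x : v.KInf) : ‖v.embInf x‖ = ‖x‖ :=
  norm_algebraMap' v.CInf x

theorem norm_emb (v : Place k) (x : k) : ‖v.emb x‖ = v.abs x :=
  (v.norm_embInf _).trans (UniformSpace.Completion.norm_coe _)

instance isUltrametricDist_CInf (v : Place k) : IsUltrametricDist v.CInf :=
  IsUltrametricDist.of_normedAlgebra v.KInf

end Place

variable {v : Place k} {r : ℕ} [NeZero r] {z : Projectivization v.CInf (Fin r → v.CInf)}

theorem rep_lastIdx_ne_zero (hz : z ∈ periodDomain v r) : z.rep (lastIdx r) ≠ 0 := by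
  have := hz (Pi.single (lastIdx r) 1) (by simp)
  simpa [Pi.single_apply, apply_ite v.embInf] using this

theorem sum_embInf_mul_coord_ne_zero (hz : z ∈ periodDomain v r) {c : Fin r → v.KInf} (hc : c ≠ 0) :
    ∑ i, v.embInf (c i) * coord z i ≠ 0 := by
  simpa only [coord, mul_div_assoc, Finset.sum_div] using
    div_ne_zero (hz c hc) (rep_lastIdx_ne_zero hz)

theorem exists_mul_norm_le_norm_sum (hz : z ∈ periodDomain v r) :
    ∃ δ > 0, ∀ c : Fin r → v.KInf, δ * ‖c‖ ≤ ‖∑ i, v.embInf (c i) * coord z i‖ := by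
  let f : (Fin r → v.KInf) →ₗ[v.KInf] v.CInf := Fintype.linearCombination v.KInf (coord z)
  have hf (c) : f c = ∑ i, v.embInf (c i) * coord z i := by
    simp only [f, Fintype.linearCombination_apply, Algebra.smul_def]
    rfl
  have hker : LinearMap.ker f = ⊥ := LinearMap.ker_eq_bot'.2 fun c hc => by
    by_contra h
    exact sum_embInf_mul_coord_ne_zero hz h (hf c ▸ hc)
  -- a linear map out of a finite-dimensional space over a complete field is bounded below
  -- as soon as it is injective
  obtain ⟨K, hK, hK'⟩ := f.exists_antilipschitzWith hker
  refine ⟨(K : ℝ)⁻¹, by positivity, fun c => ?_⟩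
  rw [inv_mul_le_iff₀ (by positivity), ← hf]
  exact hK'.le_mul_norm (map_zero f) c

theorem coord_add_sum_Ioi_eq_sum (i : Fin r) (u : Fin r → v.KInf) :
    coord z i + ∑ j ∈ Finset.Ioi i, v.embInf (u j) * coord z j =
      ∑ j, v.embInf (if j = i then 1 else if i < j then u j else 0) * coord z j := by
  rw [← Finset.add_sum_erase _ _ (Finset.mem_univ i), if_pos rfl, map_one, one_mul]
  congr 1
  have hsub : Finset.Ioi i ⊆ Finset.univ.erase i := fun j hj =>
    Finset.mem_erase.2 ⟨(Finset.mem_Ioi.1 hj).ne', Finset.mem_univ j⟩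
  rw [← Finset.sum_subset hsub fun j hj hj' => ?_]
  · refine Finset.sum_congr rfl fun j hj => ?_
    rw [Finset.mem_Ioi] at hj
    rw [if_neg hj.ne', if_pos hj]
  · rw [Finset.mem_Ioi] at hj'
    rw [if_neg (Finset.ne_of_mem_erase hj), if_neg hj', map_zero, zero_mul]

theorem totalIm_pos (hz : z ∈ periodDomain v r) : 0 < totalIm z := by
  obtain ⟨δ, hδ, h⟩ := exists_mul_norm_le_norm_sum hz
  refine Finset.prod_pos fun i _ => hδ.trans_le (le_ciInf fun u => ?_)
  rw [coord_add_sum_Ioi_eq_sum]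
  refine le_trans (le_mul_of_one_le_right hδ.le ?_) (h _)
  exact le_of_eq_of_le (by simp) (norm_le_pi_norm _ i)

theorem exists_mul_abs_le_norm_evalMap (hz : z ∈ periodDomain v r) :
    ∃ δ > 0, ∀ (x : Fin r → k) (i : Fin r), δ * v.abs (x i) ≤ ‖evalMap z x‖ := by
  obtain ⟨δ, hδ, h⟩ := exists_mul_norm_le_norm_sum hz
  refine ⟨δ, hδ, fun x i => le_trans ?_ (h fun i => algebraMap k v.KInf (x i))⟩
  refine mul_le_mul_of_nonneg_left ?_ hδ.le
  calc v.abs (x i) = ‖algebraMap k v.KInf (x i)‖ :=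
        (v.norm_emb (x i)).symm.trans (v.norm_embInf _)
    _ ≤ _ := norm_le_pi_norm (fun i => algebraMap k v.KInf (x i)) i

theorem evalMap_injective (hz : z ∈ periodDomain v r) : Function.Injective (evalMap z) := by
  obtain ⟨δ, hδ, h⟩ := exists_mul_abs_le_norm_evalMap hz
  refine (injective_iff_map_eq_zero _).2 fun x hx => funext fun i => ?_
  have hxi : δ * v.abs (x i) ≤ 0 := by simpa only [hx, norm_zero] using h x i
  exact v.abs.eq_zero.1 ((nonpos_of_mul_nonpos_right hxi hδ).antisymm (v.abs.nonneg _))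

theorem evalMap_smul (z : Projectivization v.CInf (Fin r → v.CInf)) (a : k) (x : Fin r → k) :
    evalMap z (a • x) = v.emb a * evalMap z x := by
  change ∑ i, v.emb (a * x i) * coord z i = v.emb a * ∑ i, v.emb (x i) * coord z i
  simp only [map_mul, mul_assoc, Finset.mul_sum]

theorem mulLattice_lattice (Y : Submodule v.ringAway (Fin r → k))
    (z : Projectivization v.CInf (Fin r → v.CInf)) (a : k) :
    mulLattice a (lattice Y z) =
      (Y.toAddSubgroup.map (DistribSMul.toAddMonoidHom (Fin r → k) a)).map (evalMap z) := by
  rw [mulLattice, lattice, AddSubgroup.map_map, AddSubgroup.map_map]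
  congr 1
  ext x
  exact (evalMap_smul z a _).symm

theorem mulLattice_lattice_le (Y : Submodule v.ringAway (Fin r → k))
    (z : Projectivization v.CInf (Fin r → v.CInf)) {a : k} (ha : a ∈ v.ringAway) :
    mulLattice a (lattice Y z) ≤ lattice Y z := by
  rw [mulLattice_lattice, lattice]
  refine AddSubgroup.map_mono ?_
  rintro _ ⟨y, hy, rfl⟩
  exact Y.smul_mem ⟨a, ha⟩ hy

theorem relIndex_mulLattice_lattice (hz : z ∈ periodDomain v r)
    (Y : Submodule v.ringAway (Fin r → k)) (a : k) :
    (mulLattice a (lattice Y z)).relIndex (lattice Y z) =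
      (Y.toAddSubgroup.map (DistribSMul.toAddMonoidHom (Fin r → k) a)).relIndex
        Y.toAddSubgroup := by
  rw [mulLattice_lattice, lattice,
    AddSubgroup.relIndex_map_map_of_injective _ _ (evalMap_injective hz)]

theorem isStronglyDiscrete_lattice (hz : z ∈ periodDomain v r)
    (Y : Submodule v.ringAway (Fin r → k))
    (hfin : ∀ m, Finite (Y.toAddSubgroup ⊓ v.piBall (Fin r) m : AddSubgroup (Fin r → k))) :
    IsStronglyDiscrete (lattice Y z) := by
  intro ρ
  obtain ⟨δ, hδ, h⟩ := exists_mul_abs_le_norm_evalMap hz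
  obtain ⟨n, hn⟩ := pow_unbounded_of_one_lt (ρ / δ)
    (show (1 : ℝ) < v.base by exact_mod_cast v.one_lt_base)
  have hS : Set.Finite (↑(Y.toAddSubgroup ⊓ v.piBall (Fin r) n) : Set (Fin r → k)) := hfin n
  refine (hS.image (evalMap z)).subset ?_
  rintro _ ⟨⟨y, hy, rfl⟩, hl⟩
  refine ⟨y, ⟨hy, Place.mem_piBall.2 fun i => v.abs_le_zpow_iff.1 ?_⟩, rfl⟩
  calc v.abs (y i) ≤ ρ / δ := (le_div_iff₀' hδ).2 ((h y i).trans hl)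
    _ ≤ (v.base : ℝ) ^ (n : ℤ) := by rw [zpow_natCast]; exact hn.le

end Period

section Multiplication

variable {k : Type*} [Field k] {v : Place k} {a : k}

theorem mem_divLattice {L : AddSubgroup v.CInf} {x : v.CInf} :
    x ∈ divLattice a L ↔ v.emb a * x ∈ L := Iff.rfl

theorem mulLattice_divLattice (ha : a ≠ 0) (L : AddSubgroup v.CInf) :
    mulLattice a (divLattice a L) = L := by
  have ha' : v.emb a ≠ 0 := (map_ne_zero _).2 ha
  ext x
  refine ⟨fun ⟨_, hl, hx⟩ => hx ▸ hl, fun hx => ⟨(v.emb a)⁻¹ * x, ?_, mul_inv_cancel_left₀ ha' x⟩⟩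
  rwa [SetLike.mem_coe, mem_divLattice, mul_inv_cancel_left₀ ha']

theorem le_divLattice_iff {L : AddSubgroup v.CInf} : L ≤ divLattice a L ↔ mulLattice a L ≤ L :=
  AddSubgroup.map_le_iff_le_comap.symm

theorem relIndex_divLattice (ha : a ≠ 0) (L : AddSubgroup v.CInf) :
    L.relIndex (divLattice a L) = (mulLattice a L).relIndex L := by
  have hinj : Function.Injective (AddMonoidHom.mulLeft (v.emb a)) :=
    mul_right_injective₀ ((map_ne_zero _).2 ha)
  nth_rw 4 [← mulLattice_divLattice ha L]
  exact (AddSubgroup.relIndex_map_map_of_injective _ _ hinj).symm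

/-- Multiplication by `a` as a bijection `L ≃ a L`. -/
def mulLatticeEquiv (ha : a ≠ 0) (L : AddSubgroup v.CInf) : L ≃ mulLattice a L :=
  (AddSubgroup.equivMapOfInjective L (AddMonoidHom.mulLeft (v.emb a))
    (mul_right_injective₀ ((map_ne_zero _).2 ha))).toEquiv

theorem norm_mulLatticeEquiv (ha : a ≠ 0) (L : AddSubgroup v.CInf) (l : L) :
    ‖(mulLatticeEquiv ha L l : v.CInf)‖ = v.abs a * ‖(l : v.CInf)‖ :=
  (norm_mul _ _).trans (congrArg (· * _) (v.norm_emb a))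

end Multiplication

section Counting

/-- The closed ball of radius `ρ` about `0` in an ultrametric group, as a subgroup. Mathlib's
`IsUltrametricDist.closedBall_openAddSubgroup` would require a proof of `0 < ρ`. -/
def normBall (G : Type*) [SeminormedAddCommGroup G] [IsUltrametricDist G] (ρ : ℝ≥0) :
    AddSubgroup G where
  carrier := {x | ‖x‖ ≤ ρ}
  zero_mem' := by simp
  add_mem' hx hy := (IsUltrametricDist.norm_add_le_max _ _).trans (max_le hx hy)
  neg_mem' hx := (norm_neg _).trans_le hx

theorem card_inf_le_relIndex_mul_card_inf {G : Type*} [AddGroup G] {M L : AddSubgroup G}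
    (hML : M ≤ L) (h : M.relIndex L ≠ 0) (B : AddSubgroup G) :
    Nat.card (L ⊓ B : AddSubgroup G) ≤
      M.relIndex L * Nat.card (M ⊓ B : AddSubgroup G) := by
  have hinf : M ⊓ (L ⊓ B) = M ⊓ B := by rw [← inf_assoc, inf_eq_left.2 hML]
  calc Nat.card (L ⊓ B : AddSubgroup G)
      = Nat.card (M ⊓ B : AddSubgroup G) * (M ⊓ B).relIndex (L ⊓ B) := by
        rw [← AddSubgroup.relIndex_bot_left, ← AddSubgroup.relIndex_bot_left,
          AddSubgroup.relIndex_mul_relIndex _ _ _ bot_le (inf_le_inf_right _ hML)]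
    _ = M.relIndex (L ⊓ B) * Nat.card (M ⊓ B : AddSubgroup G) := by
        rw [mul_comm, ← hinf, AddSubgroup.inf_relIndex_right]
    _ ≤ M.relIndex L * Nat.card (M ⊓ B : AddSubgroup G) :=
        Nat.mul_le_mul_right _ (AddSubgroup.relIndex_le_of_le_right inf_le_left h)

theorem mulLattice_inf_normBall {k : Type*} [Field k] {v : Place k} {a : k} {b : ℝ≥0}
    (hab : v.abs a = b) (hb : 0 < b) (L : AddSubgroup v.CInf) (ρ : ℝ≥0) :
    mulLattice a L ⊓ normBall v.CInf (b * ρ) = mulLattice a (L ⊓ normBall v.CInf ρ) := by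
  have hnorm (l : v.CInf) : ‖v.emb a * l‖ ≤ (b * ρ : ℝ≥0) ↔ ‖l‖ ≤ ρ := by
    rw [norm_mul, v.norm_emb, hab, NNReal.coe_mul, mul_le_mul_iff_right₀ (NNReal.coe_pos.2 hb)]
  ext x
  constructor
  · rintro ⟨⟨l, hl, rfl⟩, hx⟩
    exact ⟨l, ⟨hl, (hnorm l).1 hx⟩, rfl⟩
  · rintro ⟨l, ⟨hl, hl'⟩, rfl⟩
    exact ⟨⟨l, hl, rfl⟩, (hnorm l).2 hl'⟩

theorem card_inf_normBall_pow_le {k : Type*} [Field k] {v : Place k} {a : k} {b : ℝ≥0}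
    (hab : v.abs a = b) (hb : 0 < b) {L : AddSubgroup v.CInf} (haL : mulLattice a L ≤ L)
    (hQ : (mulLattice a L).relIndex L ≠ 0) (n : ℕ) :
    Nat.card (L ⊓ normBall v.CInf (b ^ n) : AddSubgroup v.CInf) ≤
      (mulLattice a L).relIndex L ^ n *
        Nat.card (L ⊓ normBall v.CInf 1 : AddSubgroup v.CInf) := by
  have ha : a ≠ 0 := v.abs.ne_zero_iff.1 (hab.trans_ne (by exact_mod_cast hb.ne'))
  induction n with
  | zero => simp
  | succ n ih =>
    refine (card_inf_le_relIndex_mul_card_inf haL hQ _).trans ?_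
    rw [pow_succ' b, mulLattice_inf_normBall hab hb,
      ← Nat.card_congr (mulLatticeEquiv ha (L ⊓ normBall v.CInf (b ^ n))), pow_succ', mul_assoc]
    exact Nat.mul_le_mul_left _ ih

end Counting

section Summability

theorem summable_sigma_pow_of_ncard_le {ι : Type*} {f : ι → ℝ} {b C Q c : ℝ} (hc : 0 ≤ c)
    (hQ : 0 ≤ Q) (hQc : Q * c < 1) (hfin : ∀ n : ℕ, {i | f i ≤ b ^ n}.Finite)
    (hcard : ∀ n : ℕ, ({i | f i ≤ b ^ n}.ncard : ℝ) ≤ C * Q ^ n) :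
    Summable fun p : Σ n : ℕ, {i | f i ≤ b ^ n} => c ^ p.1 := by
  have (n : ℕ) : Fintype {i | f i ≤ b ^ n} := (hfin n).fintype
  rw [summable_sigma_of_nonneg fun p => pow_nonneg hc p.1]
  refine ⟨fun n => .of_finite, ?_⟩
  refine .of_nonneg_of_le (fun n => tsum_nonneg fun _ => pow_nonneg hc n) (fun n => ?_)
    ((summable_geometric_of_lt_one (mul_nonneg hQ hc) hQc).mul_left C)
  calc ∑' _ : {i | f i ≤ b ^ n}, c ^ n = ({i | f i ≤ b ^ n}.ncard : ℝ) * c ^ n := by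
        rw [tsum_const, nsmul_eq_mul, Nat.card_coe_set_eq]
    _ ≤ C * Q ^ n * c ^ n := mul_le_mul_of_nonneg_right (hcard n) (pow_nonneg hc n)
    _ = C * (Q * c) ^ n := by rw [mul_pow, mul_assoc]

theorem summable_rpow_neg_of_ncard_le {ι : Type*} {f : ι → ℝ} {b C Q t : ℝ} (hb : 1 < b)
    (hQ : 0 ≤ Q) (ht : 0 ≤ t) (hQt : Q < b ^ t) (hfin : ∀ n : ℕ, {i | f i ≤ b ^ n}.Finite)
    (hcard : ∀ n : ℕ, ({i | f i ≤ b ^ n}.ncard : ℝ) ≤ C * Q ^ n) :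
    Summable fun i => f i ^ (-t) := by
  have hb0 : 0 < b := zero_lt_one.trans hb
  have hQc : Q * b ^ (-t) < 1 := by
    rwa [Real.rpow_neg hb0.le, ← div_eq_mul_inv, div_lt_one (Real.rpow_pos_of_pos hb0 t)]
  have hsum := summable_sigma_pow_of_ncard_le (Real.rpow_nonneg hb0.le (-t)) hQ hQc hfin hcard
  rw [← (hfin 0).summable_compl_iff]
  have hf (i : ↥{i | f i ≤ b ^ 0}ᶜ) : 1 < f i := by simpa using i.2
  choose N hN hN' using fun i => exists_nat_pow_near (hf i).le hb
  let e (i : ↥{i | f i ≤ b ^ 0}ᶜ) : Σ n : ℕ, {i | f i ≤ b ^ n} := ⟨N i + 1, i, (hN' i).le⟩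
  have he : Function.Injective e := fun i j hij =>
    Subtype.ext (congrArg (fun p : Σ n : ℕ, {i | f i ≤ b ^ n} => (p.2 : ι)) hij)
  refine .of_nonneg_of_le (fun i => Real.rpow_nonneg (zero_lt_one.trans (hf i)).le _) (fun i => ?_)
    ((hsum.comp_injective he).mul_left (b ^ t))
  calc f i ^ (-t) ≤ (b ^ N i) ^ (-t) :=
        Real.rpow_le_rpow_of_nonpos (by positivity) (hN i) (neg_nonpos.2 ht)
    _ = (b ^ (-t)) ^ N i := by rw [← Real.rpow_pow_comm hb0.le]
    _ = b ^ t * (b ^ (-t)) ^ (N i + 1) := by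
        rw [pow_succ', ← mul_assoc, ← Real.rpow_add hb0, add_neg_cancel, Real.rpow_zero, one_mul]

end Summability

section NonzeroSums

variable {G E : Type*} [AddGroup G] {L : AddSubgroup G} {g : G → E}

theorem nonzero_inclusion_injective (L : AddSubgroup G) :
    Function.Injective fun l : {l : G // l ∈ L ∧ l ≠ 0} => (⟨l, l.2.1⟩ : L) :=
  fun _ _ h => Subtype.ext (Subtype.mk.inj h)

variable [AddCommMonoid E] [TopologicalSpace E]

theorem summable_nonzero_iff (hg : g 0 = 0) :
    (Summable fun l : {l : G // l ∈ L ∧ l ≠ 0} => g l) ↔ Summable fun l : L => g l := by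
  refine (nonzero_inclusion_injective L).summable_iff (f := fun l : L => g l) fun l hl => ?_
  by_contra h
  exact hl ⟨⟨l, l.2, fun h0 => h (h0 ▸ hg)⟩, rfl⟩

theorem tsum_nonzero_eq (hg : g 0 = 0) :
    ∑' l : {l : G // l ∈ L ∧ l ≠ 0}, g l = ∑' l : L, g l :=
  (nonzero_inclusion_injective L).tsum_eq (f := fun l : L => g l)
    fun l hl => ⟨⟨l, l.2, fun h0 => hl ((congrArg g h0).trans hg)⟩, rfl⟩

end NonzeroSums

section CosetSums

variable {G E : Type*} [AddCommGroup G] {L M : AddSubgroup G} {σ : M ⧸ L.addSubgroupOf M → M}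

theorem representative_mem_iff (hσ : ∀ c, QuotientAddGroup.mk (σ c) = c)
    {c : M ⧸ L.addSubgroupOf M} : (σ c : G) ∈ L ↔ c = 0 := by
  rw [← AddSubgroup.mem_addSubgroupOf, ← QuotientAddGroup.eq_zero_iff, hσ]

theorem tsum_sub_of_mem [AddCommMonoid E] [TopologicalSpace E] {w : G} (hw : w ∈ L)
    (f : G → E) : ∑' l : L, f (w - l) = ∑' l : L, f l :=
  (Equiv.subLeft (⟨w, hw⟩ : L)).tsum_eq fun l : L => f l

/-- A choice `σ` of representatives of `M / L` identifies `(M / L) × L` with `M` through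
`(c, l) ↦ σ c - l`. -/
def quotientProdEquiv (hLM : L ≤ M) (hσ : ∀ c, QuotientAddGroup.mk (σ c) = c) :
    (M ⧸ L.addSubgroupOf M) × L ≃ M where
  toFun p := ⟨σ p.1 - p.2, sub_mem (σ p.1).2 (hLM p.2.2)⟩
  invFun m := (QuotientAddGroup.mk m, ⟨σ (QuotientAddGroup.mk m) - m, by
    rw [sub_eq_neg_add]
    exact AddSubgroup.mem_addSubgroupOf.1 (QuotientAddGroup.eq.1 (hσ _).symm)⟩)
  left_inv p := by
    have h : (QuotientAddGroup.mk (⟨σ p.1 - p.2, sub_mem (σ p.1).2 (hLM p.2.2)⟩ : M) :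
        M ⧸ L.addSubgroupOf M) = p.1 := by
      rw [← hσ p.1, QuotientAddGroup.eq, AddSubgroup.mem_addSubgroupOf, hσ]
      simp
    ext
    · exact h
    · simp [h]
  right_inv m := by simp

variable [NormedAddCommGroup E] [CompleteSpace E] {f : G → E}

theorem summable_of_addSubgroup_le (hLM : L ≤ M) (hM : Summable fun m : M => f m) :
    Summable fun l : L => f l :=
  hM.comp_injective (AddSubgroup.inclusion_injective hLM)

theorem summable_sub_representative (hLM : L ≤ M) (hσ : ∀ c, QuotientAddGroup.mk (σ c) = c)
    (hM : Summable fun m : M => f m) (c : M ⧸ L.addSubgroupOf M) :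
    Summable fun l : L => f (σ c - l) :=
  ((quotientProdEquiv hLM hσ).summable_iff.2 hM).prod_factor c

theorem tsum_eq_sum_tsum_sub_representative (hLM : L ≤ M) [Fintype (M ⧸ L.addSubgroupOf M)]
    (hσ : ∀ c, QuotientAddGroup.mk (σ c) = c) (hM : Summable fun m : M => f m) :
    ∑' m : M, f m = ∑ c, ∑' l : L, f (σ c - l) := by
  rw [← (quotientProdEquiv hLM hσ).tsum_eq]
  exact ((quotientProdEquiv hLM hσ).summable_iff.2 hM).tsum_prod.trans (tsum_fintype _)

end CosetSums

section Bracket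

theorem norm_sub_eq_of_norm_lt {G : Type*} [SeminormedAddGroup G] [IsUltrametricDist G] {w l : G}
    (h : ‖w‖ < ‖l‖) : ‖l - w‖ = ‖l‖ := by
  rw [sub_eq_add_neg, IsUltrametricDist.norm_add_eq_max_of_norm_ne_norm (by simpa using h.ne'),
    norm_neg, max_eq_left h.le]

variable {k : Type*} [Field k] {v : Place k} {L M : AddSubgroup v.CInf}

theorem IsStronglyDiscrete.finite_ne_zero (hL : IsStronglyDiscrete L) (ρ : ℝ) :
    {l : v.CInf | l ∈ L ∧ l ≠ 0 ∧ ‖l‖ ≤ ρ}.Finite :=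
  (hL ρ).subset fun _ hl => ⟨hl.1, hl.2.2⟩

theorem tsum_sub_eq_bracket (hL : IsStronglyDiscrete L) {g : ℝ → ℂ} (hg : g 0 = 0) (w : v.CInf) :
    ∑' l : L, (g ‖w - l‖ - g ‖(l : v.CInf)‖) = bracket L g w := by
  classical
  have hT := hL.finite_ne_zero ‖w‖
  let φ : v.CInf → ℂ := fun l => g ‖l - w‖ - g ‖l‖
  have hsupp : ∀ l ∉ insert 0 hT.toFinset, (L : Set v.CInf).indicator φ l = 0 := by
    refine fun l hl => Set.indicator_apply_eq_zero.2 fun hlL => ?_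
    simp only [Finset.mem_insert, Set.Finite.mem_toFinset, Set.mem_ofPred_eq, not_or, not_and,
      not_le] at hl
    simp only [φ, norm_sub_eq_of_norm_lt (hl.2 hlL hl.1), sub_self]
  calc ∑' l : L, (g ‖w - l‖ - g ‖(l : v.CInf)‖) = ∑' l, (L : Set v.CInf).indicator φ l := by
        simp only [norm_sub_rev w]
        exact tsum_subtype (L : Set v.CInf) φ
    _ = φ 0 + ∑ l ∈ hT.toFinset, φ l := by
        rw [tsum_eq_sum hsupp, Finset.sum_insert (by simp), Set.indicator_of_mem (zero_mem L)]
        exact congrArg _ <| Finset.sum_congr rfl fun l hl =>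
          Set.indicator_of_mem (hT.mem_toFinset.1 hl).1 φ
    _ = bracket L g w := by
        simp only [φ, zero_sub, norm_neg, norm_zero, hg, sub_zero, bracket,
          finsum_mem_eq_finite_toFinset_sum _ hT]

theorem tsum_eq_relIndex_mul_add_cosetSum (hLM : L ≤ M) (hL : IsStronglyDiscrete L)
    [Finite (LatQuot M L)] {σ : LatQuot M L → M} (hσ : ∀ c, QuotientAddGroup.mk (σ c) = c)
    {g : ℝ → ℂ} (hg : g 0 = 0) (hM : Summable fun m : M => g ‖(m : v.CInf)‖) :
    ∑' m : M, g ‖(m : v.CInf)‖ =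
      L.relIndex M * ∑' l : L, g ‖(l : v.CInf)‖ + cosetSum M L σ g := by
  classical
  have := Fintype.ofFinite (LatQuot M L)
  have hsumL : Summable fun l : L => g ‖(l : v.CInf)‖ :=
    summable_of_addSubgroup_le (f := fun x => g ‖x‖) hLM hM
  have hterm (c : LatQuot M L) : ∑' l : L, g ‖(σ c : v.CInf) - l‖ =
      ∑' l : L, g ‖(l : v.CInf)‖ + Set.indicator {c | c ≠ 0} (fun c => bracket L g (σ c)) c := by
    by_cases h : c = 0
    · rw [tsum_sub_of_mem ((representative_mem_iff hσ).2 h) (fun x => g ‖x‖),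
        Set.indicator_of_notMem (by simp [h]), add_zero]
    · have hsum := summable_sub_representative (f := fun x => g ‖x‖) hLM hσ hM c
      rw [Set.indicator_of_mem h, ← tsum_sub_eq_bracket hL hg, hsum.tsum_sub hsumL,
        add_sub_cancel]
  rw [tsum_eq_sum_tsum_sub_representative (f := fun x => g ‖x‖) hLM hσ hM, cosetSum,
    finsum_mem_def, finsum_eq_sum_of_fintype, Finset.sum_congr rfl fun c _ => hterm c,
    Finset.sum_add_distrib, Finset.sum_const, Finset.card_univ, nsmul_eq_mul,
    AddSubgroup.relIndex, AddSubgroup.index, Nat.card_eq_fintype_card]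

end Bracket

section LatticeZeta

variable {k : Type*} [Field k] {v : Place k} {a : k} {L : AddSubgroup v.CInf} {r : ℕ} {t : ℂ}

/-- The zeta function `∑ 1 / |l| ^ t` of a lattice `L`. For `t ≠ 0` the element `l = 0` contributes
nothing, since `0 ^ t = 0` and `1 / 0 = 0`. -/
def latticeZeta (L : AddSubgroup v.CInf) (t : ℂ) : ℂ :=
  ∑' l : L, 1 / (‖(l : v.CInf)‖ : ℂ) ^ t

theorem one_div_ofReal_zero_cpow (ht : t ≠ 0) : 1 / ((0 : ℝ) : ℂ) ^ t = 0 := by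
  simp [ht]

theorem one_div_norm_mulLatticeEquiv_cpow (ha : a ≠ 0) (L : AddSubgroup v.CInf) (t : ℂ) (l : L) :
    1 / (‖(mulLatticeEquiv ha L l : v.CInf)‖ : ℂ) ^ t =
      1 / (v.abs a : ℂ) ^ t * (1 / (‖(l : v.CInf)‖ : ℂ) ^ t) := by
  rw [norm_mulLatticeEquiv, Complex.ofReal_mul,
    Complex.mul_cpow_ofReal_nonneg (v.abs.nonneg a) (norm_nonneg _), one_div_mul_one_div]

theorem abs_cpow_ne_zero (v : Place k) (ha : a ≠ 0) (t : ℂ) : (v.abs a : ℂ) ^ t ≠ 0 :=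
  fun h => ha (by simpa using (Complex.cpow_eq_zero_iff _ _).1 h |>.1)

theorem latticeZeta_mulLattice (ha : a ≠ 0) (L : AddSubgroup v.CInf) (t : ℂ) :
    latticeZeta (mulLattice a L) t = 1 / (v.abs a : ℂ) ^ t * latticeZeta L t := by
  rw [latticeZeta, ← (mulLatticeEquiv ha L).tsum_eq, latticeZeta, ← tsum_mul_left]
  exact tsum_congr (one_div_norm_mulLatticeEquiv_cpow ha L t)

theorem latticeZeta_divLattice (ha : a ≠ 0) (L : AddSubgroup v.CInf) (t : ℂ) :
    latticeZeta (divLattice a L) t = (v.abs a : ℂ) ^ t * latticeZeta L t := by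
  have h := latticeZeta_mulLattice ha (divLattice a L) t
  rw [mulLattice_divLattice ha, one_div] at h
  rw [h, mul_inv_cancel_left₀ (abs_cpow_ne_zero v ha t)]

theorem summable_divLattice (ha : a ≠ 0)
    (hL : Summable fun l : L => 1 / (‖(l : v.CInf)‖ : ℂ) ^ t) :
    Summable fun l : divLattice a L => 1 / (‖(l : v.CInf)‖ : ℂ) ^ t := by
  rw [← mulLattice_divLattice ha L, ← (mulLatticeEquiv ha (divLattice a L)).summable_iff] at hL
  exact (summable_mul_left_iff (one_div_ne_zero (abs_cpow_ne_zero v ha t))).1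
    (hL.congr (one_div_norm_mulLatticeEquiv_cpow ha (divLattice a L) t))

/-- Multiplication by the scalar `a`, of absolute value `> 1`, maps the strongly discrete lattice
`L` into itself with the index `|a| ^ r` that is to be expected of a lattice of rank `r`. -/
structure IsScaling (L : AddSubgroup v.CInf) (r : ℕ) (a : k) : Prop where
  discrete : IsStronglyDiscrete L
  mulLattice_le : mulLattice a L ≤ L
  one_lt_abs : 1 < v.abs a
  relIndex_eq : ((mulLattice a L).relIndex L : ℝ) = v.abs a ^ r

theorem ne_zero_of_natCast_lt_re (ht : r < t.re) : t ≠ 0 := by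
  rintro rfl
  exact (Nat.cast_nonneg r).not_gt ht

namespace IsScaling

theorem ne_zero (h : IsScaling L r a) : a ≠ 0 :=
  v.abs.pos_iff.1 (zero_lt_one.trans h.one_lt_abs)

theorem relIndex_ne_zero (h : IsScaling L r a) : (mulLattice a L).relIndex L ≠ 0 := fun h0 =>
  pow_ne_zero r (v.abs.ne_zero h.ne_zero) (by rw [← h.relIndex_eq, h0, Nat.cast_zero])

theorem relIndex_cast (h : IsScaling L r a) :
    ((mulLattice a L).relIndex L : ℂ) = (v.abs a : ℂ) ^ r := by
  exact_mod_cast congrArg ((↑) : ℝ → ℂ) h.relIndex_eq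

theorem finite_quot (h : IsScaling L r a) : Finite (LatQuot L (mulLattice a L)) :=
  AddSubgroup.index_ne_zero_iff_finite.1 h.relIndex_ne_zero

theorem finite_div_quot (h : IsScaling L r a) : Finite (LatQuot (divLattice a L) L) :=
  AddSubgroup.index_ne_zero_iff_finite.1
    ((relIndex_divLattice h.ne_zero L).trans_ne h.relIndex_ne_zero)

theorem ncard_norm_le_pow_le (h : IsScaling L r a) (n : ℕ) :
    ({l : L | ‖(l : v.CInf)‖ ≤ v.abs a ^ n}.ncard : ℝ) ≤
      Nat.card (L ⊓ normBall v.CInf 1 : AddSubgroup v.CInf) * (v.abs a ^ r) ^ n := by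
  lift v.abs a to ℝ≥0 using v.abs.nonneg a with b hb
  have hb0 : 0 < b := zero_lt_one.trans (by exact_mod_cast hb ▸ h.one_lt_abs)
  have hcard := card_inf_normBall_pow_le hb.symm hb0 h.mulLattice_le h.relIndex_ne_zero n
  have hncard : {l : L | ‖(l : v.CInf)‖ ≤ (b : ℝ) ^ n}.ncard =
      Nat.card (L ⊓ normBall v.CInf (b ^ n) : AddSubgroup v.CInf) := by
    rw [← Set.ncard_image_of_injective _ Subtype.val_injective]
    refine congrArg Set.ncard (Set.ext fun x => ⟨?_, fun hx => ⟨⟨x, hx.1⟩, ?_, rfl⟩⟩)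
    · rintro ⟨l, hl, rfl⟩
      exact ⟨l.2, by exact_mod_cast hl⟩
    · exact_mod_cast hx.2
  rw [hncard, hb, ← h.relIndex_eq, mul_comm]
  exact_mod_cast hcard

theorem summable (h : IsScaling L r a) (ht : r < t.re) :
    Summable fun l : L => 1 / (‖(l : v.CInf)‖ : ℂ) ^ t := by
  have ht0 : 0 < t.re := (Nat.cast_nonneg r).trans_lt ht
  have hlt : v.abs a ^ r < v.abs a ^ t.re := by
    rw [← Real.rpow_natCast]
    exact Real.rpow_lt_rpow_of_exponent_lt h.one_lt_abs ht
  have hfin (n : ℕ) : {l : L | ‖(l : v.CInf)‖ ≤ v.abs a ^ n}.Finite :=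
    ((h.discrete _).preimage Subtype.val_injective.injOn).subset fun l hl => ⟨l.2, hl⟩
  refine .of_norm ((summable_rpow_neg_of_ncard_le h.one_lt_abs (by positivity) ht0.le hlt hfin
    h.ncard_norm_le_pow_le).congr fun l => ?_)
  rw [norm_div, norm_one, Complex.norm_cpow_eq_rpow_re_of_nonneg (norm_nonneg _) ht0.ne',
    Real.rpow_neg (norm_nonneg _), one_div]

theorem abs_cpow_sub_mul_latticeZeta (h : IsScaling L r a)
    {σ : LatQuot (divLattice a L) L → divLattice a L} (hσ : ∀ c, QuotientAddGroup.mk (σ c) = c)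
    (ht : r < t.re) :
    ((v.abs a : ℂ) ^ t - (v.abs a : ℂ) ^ r) * latticeZeta L t =
      cosetSum (divLattice a L) L σ fun x => 1 / (x : ℂ) ^ t := by
  have := h.finite_div_quot
  have key := tsum_eq_relIndex_mul_add_cosetSum (g := fun x => 1 / (x : ℂ) ^ t)
    (le_divLattice_iff.2 h.mulLattice_le) h.discrete hσ
    (one_div_ofReal_zero_cpow (ne_zero_of_natCast_lt_re ht))
    (summable_divLattice h.ne_zero (h.summable ht))
  rw [← latticeZeta, ← latticeZeta, latticeZeta_divLattice h.ne_zero,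
    relIndex_divLattice h.ne_zero, h.relIndex_cast] at key
  rw [sub_mul, key, add_sub_cancel_left]

theorem one_sub_abs_cpow_mul_latticeZeta (h : IsScaling L r a)
    {σ : LatQuot L (mulLattice a L) → L} (hσ : ∀ c, QuotientAddGroup.mk (σ c) = c)
    (ht : r < t.re) :
    (1 - (v.abs a : ℂ) ^ (r - t)) * latticeZeta L t =
      cosetSum L (mulLattice a L) σ fun x => 1 / (x : ℂ) ^ t := by
  have := h.finite_quot
  have ha : (v.abs a : ℂ) ≠ 0 := by exact_mod_cast v.abs.ne_zero h.ne_zero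
  have key := tsum_eq_relIndex_mul_add_cosetSum (g := fun x => 1 / (x : ℂ) ^ t)
    h.mulLattice_le (h.discrete.mono h.mulLattice_le) hσ
    (one_div_ofReal_zero_cpow (ne_zero_of_natCast_lt_re ht)) (h.summable ht)
  rw [← latticeZeta, ← latticeZeta, latticeZeta_mulLattice h.ne_zero, h.relIndex_cast,
    ← mul_assoc, mul_one_div, ← Complex.cpow_natCast, ← Complex.cpow_sub _ _ ha] at key
  rw [sub_mul, one_mul, sub_eq_iff_eq_add', ← key]

end IsScaling

end LatticeZeta

section PosEvalSpan

/-- The linear combinations of evaluations `f ↦ f x` at positive reals `x`. The coset sums are of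
this form; applied to `x ↦ 1 / x ^ (r * s)` such a functional is entire in `s`, and its derivatives
at `s = 0` come from its values at the powers of the logarithm. -/
def posEvalSpan : Submodule ℂ ((ℝ → ℂ) → ℂ) :=
  Submodule.span ℂ {Φ | ∃ x : ℝ, 0 < x ∧ Φ = fun f => f x}

theorem eval_mem_posEvalSpan {x : ℝ} (hx : 0 < x) : (fun f : ℝ → ℂ => f x) ∈ posEvalSpan :=
  Submodule.subset_span ⟨x, hx, rfl⟩

theorem one_div_cpow_eq_cexp {x : ℝ} (hx : 0 < x) (r s : ℂ) :
    1 / (x : ℂ) ^ (r * s) = Complex.exp (-r * Real.log x * s) := by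
  rw [Complex.cpow_def_of_ne_zero (by exact_mod_cast hx.ne'), one_div, ← Complex.exp_neg,
    ← Complex.ofReal_log hx.le]
  congr 1
  ring

theorem differentiable_of_mem_posEvalSpan (r : ℂ) {Φ : (ℝ → ℂ) → ℂ} (hΦ : Φ ∈ posEvalSpan) :
    Differentiable ℂ fun s : ℂ => Φ fun x => 1 / (x : ℂ) ^ (r * s) := by
  induction hΦ using Submodule.span_induction with
  | mem Φ h =>
    obtain ⟨x, hx, rfl⟩ := h
    simp only [one_div_cpow_eq_cexp hx]
    fun_prop
  | zero => exact differentiable_const 0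
  | add Φ Ψ _ _ hΦ hΨ => exact hΦ.add hΨ
  | smul c Φ _ h => exact h.const_smul c

theorem iteratedDeriv_of_mem_posEvalSpan (r : ℂ) {Φ : (ℝ → ℂ) → ℂ} (hΦ : Φ ∈ posEvalSpan)
    (n : ℕ) :
    iteratedDeriv n (fun s : ℂ => Φ fun x => 1 / (x : ℂ) ^ (r * s)) 0 =
      (-r) ^ n * Φ fun x => ((Real.log x ^ n : ℝ) : ℂ) := by
  have hdiff {Ψ} (hΨ : Ψ ∈ posEvalSpan) :
      ContDiffAt ℂ n (fun s : ℂ => Ψ fun x => 1 / (x : ℂ) ^ (r * s)) 0 :=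
    (differentiable_of_mem_posEvalSpan r hΨ).contDiff.contDiffAt
  induction hΦ using Submodule.span_induction with
  | mem Φ h =>
    obtain ⟨x, hx, rfl⟩ := h
    simp only [one_div_cpow_eq_cexp hx]
    simp only [iteratedDeriv_cexp_const_mul, mul_zero, Complex.exp_zero, mul_one, mul_pow,
      Complex.ofReal_pow]
  | zero =>
    simp only [Pi.zero_apply, mul_zero]
    exact iteratedDeriv_const_zero
  | add Φ Ψ hΦ hΨ ihΦ ihΨ =>
    refine (iteratedDeriv_add (hdiff hΦ) (hdiff hΨ)).trans ?_
    rw [ihΦ, ihΨ, Pi.add_apply, mul_add]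
  | smul c Φ hΦ ih =>
    refine (iteratedDeriv_const_smul (hdiff hΦ) c).trans ?_
    rw [ih, Pi.smul_apply, smul_eq_mul, smul_eq_mul, mul_left_comm]

variable {k : Type*} [Field k] {v : Place k} {L M : AddSubgroup v.CInf}

theorem bracket_mem_posEvalSpan (hL : IsStronglyDiscrete L) {w : v.CInf} (hw : w ∉ L) :
    (fun f => bracket L f w) ∈ posEvalSpan := by
  have hT := hL.finite_ne_zero ‖w‖
  have hw0 : w ≠ 0 := fun h => hw (h ▸ zero_mem L)
  have hsum : (fun f => bracket L f w) = (fun f : ℝ → ℂ => f ‖w‖) +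
      ∑ l ∈ hT.toFinset, ((fun f : ℝ → ℂ => f ‖l - w‖) - fun f : ℝ → ℂ => f ‖l‖) := by
    ext f
    simp only [bracket, finsum_mem_eq_finite_toFinset_sum _ hT, Pi.add_apply, Finset.sum_apply,
      Pi.sub_apply]
  rw [hsum]
  refine add_mem (eval_mem_posEvalSpan (norm_pos_iff.2 hw0)) (sum_mem fun l hl => ?_)
  obtain ⟨hlL, hl0, -⟩ := hT.mem_toFinset.1 hl
  have hlw : l - w ≠ 0 := sub_ne_zero.2 fun h => hw (h ▸ hlL)
  exact sub_mem (eval_mem_posEvalSpan (norm_pos_iff.2 hlw))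
    (eval_mem_posEvalSpan (norm_pos_iff.2 hl0))

theorem cosetSum_mem_posEvalSpan (hL : IsStronglyDiscrete L) [Finite (LatQuot M L)]
    {σ : LatQuot M L → M} (hσ : ∀ c, QuotientAddGroup.mk (σ c) = c) :
    (fun f => cosetSum M L σ f) ∈ posEvalSpan := by
  have hT : {c : LatQuot M L | c ≠ 0}.Finite := Set.toFinite _
  have hsum : (fun f => cosetSum M L σ f) =
      ∑ c ∈ hT.toFinset, fun f : ℝ → ℂ => bracket L f (σ c : v.CInf) := by
    ext f
    rw [cosetSum, finsum_mem_eq_finite_toFinset_sum _ hT, Finset.sum_apply]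
  rw [hsum]
  exact sum_mem fun c hc => bracket_mem_posEvalSpan hL fun h =>
    hT.mem_toFinset.1 hc ((representative_mem_iff hσ).1 h)

end PosEvalSpan

section Continuation

theorem eq_of_meromorphicNFOn_of_eqOn {f g : ℂ → ℂ} (hf : MeromorphicNFOn f Set.univ)
    (hg : MeromorphicNFOn g Set.univ) {U : Set ℂ} (hU : IsOpen U) (hne : U.Nonempty)
    (h : Set.EqOn f g U) : f = g := by
  obtain ⟨x₀, hx₀⟩ := hne
  have hm : MeromorphicOn (f - g) Set.univ := hf.meromorphicOn.sub hg.meromorphicOn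
  have hx₀top : meromorphicOrderAt (f - g) x₀ = ⊤ := by
    refine meromorphicOrderAt_eq_top_iff.2 ?_
    filter_upwards [nhdsWithin_le_nhds (hU.mem_nhds hx₀)] with y hy
    rw [Pi.sub_apply, h hy, sub_self]
  have htop (x : ℂ) : meromorphicOrderAt (f - g) x = ⊤ := by
    by_contra hx
    exact (hm.exists_meromorphicOrderAt_ne_top_iff_forall isConnected_univ).1
      ⟨⟨x, Set.mem_univ x⟩, hx⟩ ⟨x₀, Set.mem_univ x₀⟩ hx₀top
  funext x
  have hx : f =ᶠ[𝓝[≠] x] g :=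
    (meromorphicOrderAt_eq_top_iff.1 (htop x)).mono fun y hy => sub_eq_zero.1 hy
  exact ((MeromorphicNFAt.eventuallyEq_nhdsNE_iff_eventuallyEq_nhds (hf (Set.mem_univ x))
    (hg (Set.mem_univ x))).1 hx).eq_of_nhds

theorem toMeromorphicNFOn_div_apply {f g : ℂ → ℂ} (hf : Differentiable ℂ f)
    (hg : Differentiable ℂ g) {s : ℂ} (hs : g s ≠ 0) :
    toMeromorphicNFOn (f / g) Set.univ s = f s / g s := by
  have hmero : MeromorphicOn (f / g) Set.univ := fun x _ =>
    (hf.analyticAt x).meromorphicAt.div (hg.analyticAt x).meromorphicAt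
  have hNF : MeromorphicNFAt (f / g) s :=
    ((hf.analyticAt s).div (hg.analyticAt s) hs).meromorphicNFAt
  rw [toMeromorphicNFOn_eq_toMeromorphicNFAt hmero (Set.mem_univ s),
    toMeromorphicNFAt_eq_self.2 hNF, Pi.div_apply]

variable {k : Type*} [Field k] {v : Place k} {r : ℕ} [NeZero r]
  {Y : Submodule v.ringAway (Fin r → k)} {z : Projectivization v.CInf (Fin r → v.CInf)}

theorem IsEisenstein.unique {E E' : ℂ → ℂ} (h : IsEisenstein Y z E) (h' : IsEisenstein Y z E') :
    E = E' :=
  eq_of_meromorphicNFOn_of_eqOn h.1 h'.1 (U := {s | 1 < s.re})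
    (isOpen_lt continuous_const Complex.continuous_re) ⟨2, by simp⟩
    fun s hs => (h.2 s hs).trans (h'.2 s hs).symm

theorem natCast_lt_re_natCast_mul {s : ℂ} (hs : 1 < s.re) : r < ((r : ℂ) * s).re := by
  rw [← Complex.ofReal_natCast, Complex.re_ofReal_mul]
  exact lt_mul_of_one_lt_right (by exact_mod_cast Nat.pos_of_ne_zero (NeZero.ne r)) hs

theorem natCast_mul_ne_zero_of_one_lt_re {s : ℂ} (hs : 1 < s.re) : (r : ℂ) * s ≠ 0 :=
  ne_zero_of_natCast_lt_re (natCast_lt_re_natCast_mul hs)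

theorem tsum_eisTerm {s : ℂ} (hs : 1 < s.re) :
    ∑' l : {l : v.CInf // l ∈ lattice Y z ∧ l ≠ 0}, eisTerm z s l =
      (totalIm z : ℂ) ^ s * latticeZeta (lattice Y z) (r * s) := by
  rw [latticeZeta, ← tsum_nonzero_eq (g := fun l => 1 / (‖l‖ : ℂ) ^ ((r : ℂ) * s))
    (by simp only [norm_zero, one_div_ofReal_zero_cpow (natCast_mul_ne_zero_of_one_lt_re hs)]),
    ← tsum_mul_left]
  exact tsum_congr fun l => div_eq_mul_one_div _ _

theorem summable_eisTerm {s : ℂ} (hs : 1 < s.re)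
    (h : Summable fun l : lattice Y z => 1 / (‖(l : v.CInf)‖ : ℂ) ^ ((r : ℂ) * s)) :
    Summable fun l : {l : v.CInf // l ∈ lattice Y z ∧ l ≠ 0} => eisTerm z s (l : v.CInf) := by
  rw [← summable_nonzero_iff (g := fun l => 1 / (‖l‖ : ℂ) ^ ((r : ℂ) * s))
    (by simp only [norm_zero, one_div_ofReal_zero_cpow (natCast_mul_ne_zero_of_one_lt_re hs)])] at h
  exact (h.mul_left ((totalIm z : ℂ) ^ s)).congr fun l => (div_eq_mul_one_div _ _).symm

theorem totalIm_cpow_ne_zero (hz : z ∈ periodDomain v r) (s : ℂ) : (totalIm z : ℂ) ^ s ≠ 0 :=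
  fun h => (totalIm_pos hz).ne' (by exact_mod_cast ((Complex.cpow_eq_zero_iff _ _).1 h).1)

theorem differentiable_totalIm_cpow_mul (hz : z ∈ periodDomain v r) {N : ℂ → ℂ}
    (hN : Differentiable ℂ N) : Differentiable ℂ fun s => (totalIm z : ℂ) ^ s * N s :=
  (differentiable_id.const_cpow
    (.inl (by exact_mod_cast (totalIm_pos hz).ne'))).mul hN

variable {D N : ℂ → ℂ}

theorem isEisenstein_toMeromorphicNFOn (hz : z ∈ periodDomain v r) (hD : Differentiable ℂ D)
    (hN : Differentiable ℂ N) (hD0 : ∀ s : ℂ, 1 < s.re → D s ≠ 0)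
    (hDN : ∀ s : ℂ, 1 < s.re → D s * latticeZeta (lattice Y z) (r * s) = N s) :
    IsEisenstein Y z
      (toMeromorphicNFOn ((fun s => (totalIm z : ℂ) ^ s * N s) / D) Set.univ) := by
  refine ⟨meromorphicNFOn_toMeromorphicNFOn _ _, fun s hs => ?_⟩
  rw [toMeromorphicNFOn_div_apply (differentiable_totalIm_cpow_mul hz hN) hD (hD0 s hs),
    tsum_eisTerm hs, ← hDN s hs, mul_left_comm, mul_div_cancel_left₀ _ (hD0 s hs)]

theorem IsEisenstein.eq_div {E : ℂ → ℂ} (hE : IsEisenstein Y z E) (hz : z ∈ periodDomain v r)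
    (hD : Differentiable ℂ D) (hN : Differentiable ℂ N) (hD0 : ∀ s : ℂ, 1 < s.re → D s ≠ 0)
    (hDN : ∀ s : ℂ, 1 < s.re → D s * latticeZeta (lattice Y z) (r * s) = N s)
    {s : ℂ} (hs : D s ≠ 0) : E s = (totalIm z : ℂ) ^ s * N s / D s := by
  rw [hE.unique (isEisenstein_toMeromorphicNFOn hz hD hN hD0 hDN),
    toMeromorphicNFOn_div_apply (differentiable_totalIm_cpow_mul hz hN) hD hs]

theorem exists_isEisenstein_of_finite (hz : z ∈ periodDomain v r) [Finite (lattice Y z)] :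
    ∃ E, IsEisenstein Y z E := by
  classical
  have := Fintype.ofFinite (lattice Y z)
  have hN : Differentiable ℂ fun s : ℂ => ∑ l : lattice Y z with l ≠ 0,
      1 / (‖(l : v.CInf)‖ : ℂ) ^ ((r : ℂ) * s) := by
    refine .fun_sum fun l hl => differentiable_of_mem_posEvalSpan r (eval_mem_posEvalSpan ?_)
    exact norm_pos_iff.2 (Subtype.coe_ne_coe.2 (Finset.mem_filter.1 hl).2)
  refine ⟨_, isEisenstein_toMeromorphicNFOn hz (differentiable_const 1) hN
    (fun _ _ => one_ne_zero) fun s hs => ?_⟩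
  rw [one_mul, latticeZeta, tsum_fintype]
  refine (Finset.sum_filter_of_ne (p := (· ≠ 0)) fun l _ hl h0 => hl ?_).symm
  rw [h0, ZeroMemClass.coe_zero, norm_zero,
    one_div_ofReal_zero_cpow (natCast_mul_ne_zero_of_one_lt_re hs)]

end Continuation

section ScalingLattice

variable {k : Type*} [Field k] {v : Place k} {a : k} {r : ℕ}

theorem re_eq_of_ofReal_cpow_eq {b : ℝ} (hb : 1 < b) {s t : ℂ}
    (h : (b : ℂ) ^ s = (b : ℂ) ^ t) : s.re = t.re := by
  have hb0 : 0 < b := zero_lt_one.trans hb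
  rw [← Real.rpow_right_inj hb0 hb.ne', ← Complex.norm_cpow_eq_rpow_re_of_pos hb0,
    ← Complex.norm_cpow_eq_rpow_re_of_pos hb0, h]

theorem differentiable_cosetSum {L M : AddSubgroup v.CInf} (hL : IsStronglyDiscrete L)
    [Finite (LatQuot M L)] {σ : LatQuot M L → M} (hσ : ∀ c, QuotientAddGroup.mk (σ c) = c)
    (r : ℂ) : Differentiable ℂ fun s : ℂ => cosetSum M L σ fun x => 1 / (x : ℂ) ^ (r * s) :=
  differentiable_of_mem_posEvalSpan r (cosetSum_mem_posEvalSpan hL hσ)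

namespace IsScaling

theorem differentiable_abs_cpow {L : AddSubgroup v.CInf} (h : IsScaling L r a) {f : ℂ → ℂ}
    (hf : Differentiable ℂ f) : Differentiable ℂ fun s => (v.abs a : ℂ) ^ f s :=
  hf.const_cpow (.inl (by exact_mod_cast v.abs.ne_zero h.ne_zero))

variable [NeZero r]

theorem abs_cpow_sub_ne_zero {L : AddSubgroup v.CInf} (h : IsScaling L r a) {s : ℂ}
    (hs : 1 < s.re) : (v.abs a : ℂ) ^ ((r : ℂ) * s) - (v.abs a : ℂ) ^ r ≠ 0 := by
  rw [sub_ne_zero, ← Complex.cpow_natCast]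
  exact fun heq => (natCast_lt_re_natCast_mul hs).ne' (re_eq_of_ofReal_cpow_eq h.one_lt_abs heq)

theorem one_sub_abs_cpow_ne_zero {L : AddSubgroup v.CInf} (h : IsScaling L r a) {s : ℂ}
    (hs : s.re ≠ 1) : 1 - (v.abs a : ℂ) ^ ((r : ℂ) * (1 - s)) ≠ 0 := by
  intro heq
  have hre := re_eq_of_ofReal_cpow_eq h.one_lt_abs
    ((Complex.cpow_zero _).trans (sub_eq_zero.1 heq))
  rw [← Complex.ofReal_natCast, Complex.re_ofReal_mul, Complex.sub_re, Complex.one_re,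
    Complex.zero_re, zero_eq_mul, sub_eq_zero] at hre
  exact hre.elim (Nat.cast_ne_zero.2 (NeZero.ne r)) hs.symm

variable {Y : Submodule v.ringAway (Fin r → k)} {z : Projectivization v.CInf (Fin r → v.CInf)}
  {E : ℂ → ℂ}

theorem exists_isEisenstein (h : IsScaling (lattice Y z) r a) (hz : z ∈ periodDomain v r) :
    ∃ E, IsEisenstein Y z E := by
  have := h.finite_div_quot
  have hσ (c : LatQuot (divLattice a (lattice Y z)) (lattice Y z)) :
      QuotientAddGroup.mk c.out = c := c.out_eq
  exact ⟨_, isEisenstein_toMeromorphicNFOn hz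
    ((h.differentiable_abs_cpow (differentiable_id.const_mul _)).sub_const _)
    (differentiable_cosetSum h.discrete hσ r) (fun s hs => h.abs_cpow_sub_ne_zero hs)
    fun s hs => h.abs_cpow_sub_mul_latticeZeta hσ (natCast_lt_re_natCast_mul hs)⟩

theorem eisenstein_eq (h : IsScaling (lattice Y z) r a) (hz : z ∈ periodDomain v r)
    (hE : IsEisenstein Y z E)
    {σ : LatQuot (divLattice a (lattice Y z)) (lattice Y z) → divLattice a (lattice Y z)}
    (hσ : ∀ c, QuotientAddGroup.mk (σ c) = c) {s : ℂ}
    (hs : (v.abs a : ℂ) ^ ((r : ℂ) * s) ≠ (v.abs a : ℂ) ^ r) :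
    E s = (totalIm z : ℂ) ^ s / ((v.abs a : ℂ) ^ ((r : ℂ) * s) - (v.abs a : ℂ) ^ r) *
      cosetSum (divLattice a (lattice Y z)) (lattice Y z) σ
        fun x => 1 / (x : ℂ) ^ ((r : ℂ) * s) := by
  have := h.finite_div_quot
  rw [hE.eq_div hz ((h.differentiable_abs_cpow (differentiable_id.const_mul _)).sub_const _)
    (differentiable_cosetSum h.discrete hσ r) (fun s hs => h.abs_cpow_sub_ne_zero hs)
    (fun s hs => h.abs_cpow_sub_mul_latticeZeta hσ (natCast_lt_re_natCast_mul hs))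
    (sub_ne_zero.2 hs), mul_div_right_comm]

theorem eventuallyEq_cosetSum (h : IsScaling (lattice Y z) r a) (hz : z ∈ periodDomain v r)
    (hE : IsEisenstein Y z E) {σ : LatQuot (lattice Y z) (mulLattice a (lattice Y z)) → lattice Y z}
    (hσ : ∀ c, QuotientAddGroup.mk (σ c) = c) :
    (fun s : ℂ => (1 - (v.abs a : ℂ) ^ ((r : ℂ) * (1 - s))) / (totalIm z : ℂ) ^ s * E s) =ᶠ[𝓝 0]
      fun s => cosetSum (lattice Y z) (mulLattice a (lattice Y z)) σ
        fun x => 1 / (x : ℂ) ^ ((r : ℂ) * s) := by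
  have := h.finite_quot
  have hdiff : Differentiable ℂ fun s : ℂ => 1 - (v.abs a : ℂ) ^ ((r : ℂ) * (1 - s)) :=
    (h.differentiable_abs_cpow ((differentiable_id.const_sub 1).const_mul _)).const_sub 1
  have hzeta (s : ℂ) (hs : 1 < s.re) := mul_one_sub (r : ℂ) s ▸
    h.one_sub_abs_cpow_mul_latticeZeta hσ (natCast_lt_re_natCast_mul hs)
  have hnhds : {s : ℂ | s.re < 1} ∈ 𝓝 0 :=
    (isOpen_lt Complex.continuous_re continuous_const).mem_nhds (by simp)
  filter_upwards [hnhds] with s hs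
  have hD := h.one_sub_abs_cpow_ne_zero (ne_of_lt hs)
  rw [hE.eq_div hz hdiff (differentiable_cosetSum (h.discrete.mono h.mulLattice_le) hσ r)
    (fun s hs => h.one_sub_abs_cpow_ne_zero hs.ne') hzeta hD,
    div_mul_div_comm, mul_left_comm, mul_div_mul_left _ _ (totalIm_cpow_ne_zero hz s),
    mul_div_cancel_left₀ _ hD]

theorem analyticAt_zero (h : IsScaling (lattice Y z) r a) (hz : z ∈ periodDomain v r)
    (hE : IsEisenstein Y z E) :
    AnalyticAt ℂ (fun s : ℂ => (1 - (v.abs a : ℂ) ^ ((r : ℂ) * (1 - s))) /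
      (totalIm z : ℂ) ^ s * E s) 0 := by
  have := h.finite_quot
  have hσ (c : LatQuot (lattice Y z) (mulLattice a (lattice Y z))) :
      QuotientAddGroup.mk c.out = c := c.out_eq
  exact ((differentiable_cosetSum (h.discrete.mono h.mulLattice_le) hσ r).analyticAt 0).congr
    (h.eventuallyEq_cosetSum hz hE hσ).symm

theorem iteratedDeriv_zero (h : IsScaling (lattice Y z) r a) (hz : z ∈ periodDomain v r)
    (hE : IsEisenstein Y z E) {σ : LatQuot (lattice Y z) (mulLattice a (lattice Y z)) → lattice Y z}
    (hσ : ∀ c, QuotientAddGroup.mk (σ c) = c) (n : ℕ) :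
    iteratedDeriv n (fun s : ℂ => (1 - (v.abs a : ℂ) ^ ((r : ℂ) * (1 - s))) /
      (totalIm z : ℂ) ^ s * E s) 0 =
      (-(r : ℂ)) ^ n * cosetSum (lattice Y z) (mulLattice a (lattice Y z)) σ
        fun x => ((Real.log x ^ n : ℝ) : ℂ) := by
  have := h.finite_quot
  rw [(h.eventuallyEq_cosetSum hz hE hσ).iteratedDeriv_eq]
  exact iteratedDeriv_of_mem_posEvalSpan r
    (cosetSum_mem_posEvalSpan (h.discrete.mono h.mulLattice_le) hσ) n

end IsScaling

end ScalingLattice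

section Main

variable {F k : Type*} [Field F] [Finite F] [Field k] [Algebra F k]
  {v : Place k} {r : ℕ} [NeZero r] {Y : Submodule v.ringAway (Fin r → k)}
  {z : Projectivization v.CInf (Fin r → v.CInf)}

theorem finite_lattice_of_ringAway_subset (hA : ∀ x ∈ v.ringAway, x ∈ Set.range (algebraMap F k))
    [Module.Finite v.ringAway Y] : Finite (lattice Y z) := by
  have : Finite v.ringAway := (Set.finite_range (algebraMap F k)).subset hA
  have : Finite Y := Module.finite_of_finite v.ringAway
  exact Set.Finite.image (evalMap z) (show (Y : Set (Fin r → k)).Finite from Set.toFinite _)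

theorem isScaling_lattice (hfg : (⊤ : IntermediateField F k).FG)
    (htr : Algebra.trdeg F k = 1) (hconst : algebraicClosure F k = ⊥)
    [Module.Finite v.ringAway Y] (hrank : Module.finrank v.ringAway Y = r)
    (hz : z ∈ periodDomain v r) {a : k} (ha : a ∈ v.ringAway)
    (ha' : a ∉ Set.range (algebraMap F k)) : IsScaling (lattice Y z) r a := by
  have hta := transcendental_of_notMem_range hconst ha'
  have ha1 := Place.one_lt_val_of_mem_ringAway hfg htr hconst ha ha'
  have := finiteDimensional_adjoin_of_transcendental hfg htr hta
  have := Place.finite_residueField (F := F) v ha1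
  have hfrac := Place.exists_mul_mem_ringAway htr ha hta
  have := Place.isFractionRing_ringAway fun y =>
    (hfrac y).imp fun d hd => hd.imp_left fun hdA => Place.adjoin_le_ringAway ha hdA
  have htop := Place.exists_sup_piBall_eq_top Y (hrank.trans (Fintype.card_fin r).symm)
    (Place.exists_sup_ball_eq_top ha ha1 hfrac)
  have hfin := Place.finite_inf_piBall Y (Place.finite_ringAway_inf_ball hfg htr hconst v)
  have ha0 : v.val a ≠ 0 := (zero_lt_one.trans ha1).ne'
  rw [← WithZero.exp_log ha0, ← WithZero.exp_zero, WithZero.exp_lt_exp] at ha1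
  obtain ⟨n, hn⟩ := Int.eq_ofNat_of_zero_le ha1.le
  have hval : v.val a = exp (n : ℤ) := by rw [← hn, WithZero.exp_log ha0]
  have habs : v.abs a = (v.q : ℝ) ^ n := by
    rw [v.abs_eq_zpow hval, zpow_natCast, v.base_eq_q, NNReal.coe_natCast]
  have hone_lt : 1 < v.abs a := by
    rw [habs]
    exact one_lt_pow₀ (by exact_mod_cast v.two_le_q) (by omega)
  refine ⟨isStronglyDiscrete_lattice hz Y hfin, mulLattice_lattice_le Y z ha, hone_lt, ?_⟩
  rw [relIndex_mulLattice_lattice hz, Place.relIndex_map_smul Y htop hfin ha hval,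
    Fintype.card_fin, habs, Nat.cast_pow, Nat.cast_pow]

end Main

end DrinfeldEisenstein

end

theorem corollary2p11 (F k : Type*) [Field F] [Finite F] [Field k] [Algebra F k]
    (hfg : (⊤ : IntermediateField F k).FG) (htr : Algebra.trdeg F k = 1)
    (hconst : algebraicClosure F k = ⊥)
    (v : Place k) (r : ℕ) [NeZero r]
    (Y : Submodule v.ringAway (Fin r → k))
    (hproj : Module.Projective v.ringAway Y) (hrank : Module.finrank v.ringAway Y = r)
    (z : Projectivization v.CInf (Fin r → v.CInf))
    (hz : z ∈ periodDomain v r) :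
    -- each ball contains only finitely many lattice elements
    (∀ ρ : ℝ, {l : v.CInf | l ∈ lattice Y z ∧ ‖l‖ ≤ ρ}.Finite) ∧
    -- the Eisenstein series converges absolutely for `Re s > 1` and has a continuation
    (∀ s : ℂ, 1 < s.re →
      Summable fun l : {l : v.CInf // l ∈ lattice Y z ∧ l ≠ 0} =>
        eisTerm z s (l : v.CInf)) ∧
    (∃! E : ℂ → ℂ, IsEisenstein Y z E) ∧
    ∀ E : ℂ → ℂ, IsEisenstein Y z E →
    ∀ a ∈ v.ringAway, a ∉ Set.range (algebraMap F k) →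
      -- the explicit form of the continuation
      (Finite (LatQuot (divLattice a (lattice Y z)) (lattice Y z)) ∧
        ∀ σ : LatQuot (divLattice a (lattice Y z)) (lattice Y z) → divLattice a (lattice Y z),
          (∀ c, QuotientAddGroup.mk (σ c) = c) →
          ∀ s : ℂ, (v.abs a : ℂ) ^ ((r : ℂ) * s) ≠ (v.abs a : ℂ) ^ r →
            E s = (totalIm z : ℂ) ^ s /
                ((v.abs a : ℂ) ^ ((r : ℂ) * s) - (v.abs a : ℂ) ^ r) *
              cosetSum (divLattice a (lattice Y z)) (lattice Y z) σ (fun x => 1 / (x : ℂ) ^ ((r : ℂ) * s))) ∧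
      -- the Taylor coefficients at `s = 0`
      (Finite (LatQuot (lattice Y z) (mulLattice a (lattice Y z))) ∧
        AnalyticAt ℂ (fun s : ℂ => (1 - (v.abs a : ℂ) ^ ((r : ℂ) * (1 - s))) /
          (totalIm z : ℂ) ^ s * E s) 0 ∧
        ∀ σ : LatQuot (lattice Y z) (mulLattice a (lattice Y z)) → lattice Y z,
          (∀ c, QuotientAddGroup.mk (σ c) = c) →
          ∀ n : ℕ,
            iteratedDeriv n (fun s : ℂ => (1 - (v.abs a : ℂ) ^ ((r : ℂ) * (1 - s))) /
                (totalIm z : ℂ) ^ s * E s) 0 =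
              (-(r : ℂ)) ^ n *
                cosetSum (lattice Y z) (mulLattice a (lattice Y z)) σ
                  (fun x => ((Real.log x ^ n : ℝ) : ℂ))) := by
  have := module_finite_of_projective_of_finrank_ne_zero (hrank.trans_ne (NeZero.ne r))
  by_cases hA : ∀ x ∈ v.ringAway, x ∈ Set.range (algebraMap F k)
  · -- By Riemann–Roch this case never occurs, but the finiteness of the lattice is easier to see.
    have := finite_lattice_of_ringAway_subset (Y := Y) (z := z) hA
    obtain ⟨E, hE⟩ := exists_isEisenstein_of_finite (Y := Y) hz
    exact ⟨fun ρ => Set.Finite.subset this fun l hl => hl.1,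
      fun s hs => summable_eisTerm hs Summable.of_finite,
      ⟨E, hE, fun E' hE' => hE'.unique hE⟩, fun _ _ a ha ha' => absurd (hA a ha) ha'⟩
  push Not at hA
  obtain ⟨a₀, ha₀, ha₀'⟩ := hA
  have h₀ := isScaling_lattice hfg htr hconst hrank hz ha₀ ha₀'
  obtain ⟨E, hE⟩ := h₀.exists_isEisenstein hz
  refine ⟨h₀.discrete, fun s hs => summable_eisTerm hs (h₀.summable (natCast_lt_re_natCast_mul hs)),
    ⟨E, hE, fun E' hE' => hE'.unique hE⟩, fun E hE a ha ha' => ?_⟩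
  have h := isScaling_lattice hfg htr hconst hrank hz ha ha'
  exact ⟨⟨h.finite_div_quot, fun σ hσ s hs => h.eisenstein_eq hz hE hσ hs⟩,
    h.finite_quot, h.analyticAt_zero hz hE, fun σ hσ n => h.iteratedDeriv_zero hz hE hσ n⟩
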